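/- **Setting.** Let $1\le k\le\infty$ or $k=\omega$, let $\Sigma$ be a Hausdorff $C^k$ manifold of dimension $d$ and $G$ a compact Hausdorff group. An *edge* is a piecewise $C^k$, regular, continuous curve in $\Sigma$ without self-intersections (its end points may agree), considered up to reparametrisation. A *graph* $\Gamma$ is a finite set of edges any two of which meet at most in their end points; $\Gamma'$ is a *subgraph* of $\Gamma$ if every edge of $\Gamma'$ is a composition of edges of $\Gamma$ and their inverses, and $\mathcal P_\Gamma$ is the set of all subgraphs of $\Gamma$; $\mathcal P_{\Gamma'}\le\mathcal P_\Gamma$ means that $\mathcal P_{\Gamma'}\subseteq\mathcal P_\Gamma$ and $\Gamma'$ is a subgraph of $\Gamma$. A *surface* is a co-oriented $C^k$ hypersurface. A set $\breve S$ of surfaces has the *surface intersection property* for $\Gamma$ if every edge $e$ of $\Gamma$ has a surface $S_e\in\breve S$ of its own which it meets exactly once, and this in its source or in its target, while $e$ meets no other surface of $\breve S$ and no other edge of $\Gamma$ meets $S_e$ (surfaces with the same underlying set are not distinguished). *Fluxes.* For a surface $S$ and an edge $e$ put $\iota_L(S,e)=1$ (resp. $-1$) if $e$ starts on $S$ and runs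 above (resp. below) $S$ near its source, and $0$ otherwise; put $\iota_R(S,e)=-1$ (resp. $1$) if $e$ ends on $S$ and runs above (resp. below) $S$ near its target, and $0$ otherwise. The flux group $\bar G_{\breve S,\Gamma}$ consists of the finite products, in $(G\times G)^{\Gamma}$, of the maps $e\mapsto(a^{\iota_L(S,e)},b^{\iota_R(S,e)})$ with $S\in\breve S$, $a,b\in G$. It acts on $\bar{\mathcal A}_\Gamma=G^{\Gamma}$ by $(\rho\cdot\mathfrak h)(e)=\rho^L(e)\,\mathfrak h(e)\,\rho^R(e)^{-1}$. *Limit.* Let $(\Gamma_i)_{i\in\mathbb N}$ be graphs such that any two of them are subgraphs of a third, and let $\mathcal P_{\Gamma_\infty}=\bigcup_i\mathcal P_{\Gamma_i}$. Let $\bar{\mathcal A}$ be the projective limit of the spaces $\bar{\mathcal A}_{\Gamma_i}$ along the maps that evaluate holonomies along the edges of a subgraph, $\pi_i:\bar{\mathcal A}\to\bar{\mathcal A}_{\Gamma_i}$ the projections, $\beta_i(f)=f\circ\pi_i$ for $f\in C(\bar{\mathcal A}_{\Gamma_i})$, and $\mu_i$ the normalised Haar measure of $\bar{\mathcal A}_{\Gamma_i}=G^{N_i}$.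 Let $\bar G_{\breve S,\Gamma_\infty}$ be the group of those families $\rho\in\prod_i\bar G_{\breve S,\Gamma_i}$ whose translation $\mathfrak h\mapsto\rho\cdot\mathfrak h$ of $\prod_i\bar{\mathcal A}_{\Gamma_i}$ satisfies $\rho\cdot\mathfrak h\in\bar{\mathcal A}\Leftrightarrow\mathfrak h\in\bar{\mathcal A}$. **Proposition.** Let $\mathbb S$ be a non-empty set of sets of surfaces such that every $\breve S\in\mathbb S$ has the surface intersection property for every $\Gamma_i$ (in particular $\mathbb S=\{\breve S\}$ with one such set $\breve S$). Then $\{\mathcal P_{\Gamma_i}\}$ is an inductive family of finite graph systems with limit $\mathcal P_{\Gamma_\infty}$ (a graph $\Delta$ belongs to $\mathcal P_{\Gamma_\infty}$ if and only if $\mathcal P_\Delta\le\mathcal P_{\Gamma_i}$ for some $i$). Each $\beta_i$ is injective and $\bigcup_i\beta_i(C(\bar{\mathcal A}_{\Gamma_i}))$ is dense in $C(\bar{\mathcal A})$; there is exactly one regular Borel measure $\mu$ on $\bar{\mathcal A}$ with $(\pi_i)_*\mu=\mu_i$ for all $i$; and the union of the spaces $\{\varphi\circ\pi_i:\varphi\in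 L^2(\mu_i)\}$ is dense in $\mathcal H_\infty:=L^2(\bar{\mathcal A},\mu)$. Let $\mathrm{Weyl}(\mathbb S)$ be the C*-algebra of operators on $\mathcal H_\infty$ generated by the multiplication operators $M(f)$, $f\in C(\bar{\mathcal A})$, and the Weyl elements $(U(\rho)\psi)(\mathfrak h)=\psi(\rho^{-1}\cdot\mathfrak h)$, $\rho\in\bar G_{\breve S,\Gamma_\infty}$, $\breve S\in\mathbb S$. Then $M$ is an injective *-homomorphism, each $\rho\mapsto U(\rho)$ is a homomorphism into the unitaries, and $U(\rho)M(f)U(\rho)^*=M(\alpha_\rho f)$ with $(\alpha_\rho f)(\mathfrak h)=f(\rho^{-1}\cdot\mathfrak h)$. There are a *-representation $\Phi$ of $\mathrm{Weyl}(\mathbb S)$ on $\mathcal H_\infty$, by multiplication on $C(\bar{\mathcal A})$ and by the translations above on Weyl elements, with cyclic unit vector $\Omega_M=1$, and a state $\bar\omega_M(a)=\langle\Omega_M,\Phi(a)\Omega_M\rangle$ (so that $(\mathcal H_\infty,\Phi,\Omega_M)$ is a GNS triple of $\bar\omega_M$) such that: 1. $\bar\omega_M$ is pure; 2. $\bar\omega_M(M(f))=\int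 f\,d\mu$ for $f\in C(\bar{\mathcal A})$, and $\bar\omega_M(M(\beta_i f))=\int_{G^{N_i}}f\,d\mu_i$ for all $i$ and $f\in C(\bar{\mathcal A}_{\Gamma_i})$; 3. $\bar\omega_M(U(\rho))=1$ and $\bar\omega_M(U(\rho)^*U(\rho))=1$ for all Weyl elements $U(\rho)$; 4. $\bar\omega_M(U(\rho)aU(\rho)^*)=\bar\omega_M(a)$ for all $a\in\mathrm{Weyl}(\mathbb S)$ and all $\rho\in\bar G_{\breve S,\Gamma_\infty}$, $\breve S\in\mathbb S$; 5. (uniqueness) $\bar\omega_M$ is the only state on $\mathrm{Weyl}(\mathbb S)$ that takes the value $1$ on all Weyl elements $U(\rho)$, and every state on $\mathrm{Weyl}(\mathbb S)$ that is invariant as in 4. agrees with $\bar\omega_M$ on $M(C(\bar{\mathcal A}))$. -/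

import Mathlib

open MeasureTheory Topology Set
open scoped Manifold ContDiff ENNReal InnerProductSpace

noncomputable section

namespace HolonomyFlux

/-! ### Edges, graphs, surfaces -/

/-- An edge in a `d`-dimensional manifold `Sig`: a continuous, piecewise `C^k` regular curve,
parametrised by `[0, 1]`, without self-intersections (the end points may agree). Only the values
on `[0, 1]` matter; reparametrisations are handled by `IsReparam` below. -/
structure Edge (d : ℕ) (k : WithTop ℕ∞) (Sig : Type*) [TopologicalSpace Sig]
    [ChartedSpace (EuclideanSpace ℝ (Fin d)) Sig] where
  toFun : ℝ → Sig
  continuousOn : ContinuousOn toFun (Icc 0 1)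
  piecewise : ∃ (n : ℕ) (τ : Fin (n + 1) → ℝ), StrictMono τ ∧ τ 0 = 0 ∧ τ (Fin.last n) = 1 ∧
    ∀ m : Fin n,
      ContMDiffOn 𝓘(ℝ, ℝ) (𝓡 d) k toFun (Icc (τ m.castSucc) (τ m.succ)) ∧
      ∀ t ∈ Icc (τ m.castSucc) (τ m.succ),
        mfderivWithin 𝓘(ℝ, ℝ) (𝓡 d) toFun (Icc (τ m.castSucc) (τ m.succ)) t ≠ 0
  injOn_left : InjOn toFun (Ico 0 1)
  injOn_right : InjOn toFun (Ioc 0 1)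

/-- A graph: finitely many independent edges, that is, two different edges can meet only in
their end points. -/
structure Graph (d : ℕ) (k : WithTop ℕ∞) (Sig : Type*) [TopologicalSpace Sig]
    [ChartedSpace (EuclideanSpace ℝ (Fin d)) Sig] where
  card : ℕ
  edge : Fin card → Edge d k Sig
  independent : ∀ e f, e ≠ f → ∀ s ∈ Icc (0 : ℝ) 1, ∀ t ∈ Icc (0 : ℝ) 1,
    (edge e).toFun s = (edge f).toFun t → (s = 0 ∨ s = 1) ∧ (t = 0 ∨ t = 1)

/-- A co-oriented `C^k` hypersurface. Near each of its points it is the regular zero set of a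
`C^k` function that is positive above and negative below the surface. (Only the germs of `above`
and `below` along the surface matter.) -/
structure Surface (d : ℕ) (k : WithTop ℕ∞) (Sig : Type*) [TopologicalSpace Sig]
    [ChartedSpace (EuclideanSpace ℝ (Fin d)) Sig] where
  carrier : Set Sig
  above : Set Sig
  below : Set Sig
  locally_regular : ∀ x ∈ carrier, ∃ W : Set Sig, IsOpen W ∧ x ∈ W ∧ ∃ φ : Sig → ℝ,
    ContMDiffOn (𝓡 d) 𝓘(ℝ, ℝ) k φ W ∧
    (∀ y ∈ W ∩ carrier, mfderiv (𝓡 d) 𝓘(ℝ, ℝ) φ y ≠ 0) ∧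
    ∀ y ∈ W, (y ∈ carrier ↔ φ y = 0) ∧ (y ∈ above ↔ 0 < φ y) ∧ (y ∈ below ↔ φ y < 0)

section Geometry

variable {d : ℕ} {k : WithTop ℕ∞} {Sig : Type*} [TopologicalSpace Sig]
  [ChartedSpace (EuclideanSpace ℝ (Fin d)) Sig]

/-- `c` on `[a, b]` is an orientation preserving reparametrisation of `g` on `[0, 1]`. -/
def IsReparam (c : ℝ → Sig) (a b : ℝ) (g : ℝ → Sig) : Prop :=
  ∃ φ : ℝ → ℝ, ContinuousOn φ (Icc a b) ∧ StrictMonoOn φ (Icc a b) ∧ φ a = 0 ∧ φ b = 1 ∧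
    ∀ t ∈ Icc a b, c t = g (φ t)

/-- The curve of a letter: `(e, true)` is the edge `e`, `(e, false)` its inverse. -/
def letterCurve (Γ : Graph d k Sig) (l : Fin Γ.card × Bool) : ℝ → Sig :=
  fun t => if l.2 then (Γ.edge l.1).toFun t else (Γ.edge l.1).toFun (1 - t)

/-- `c` on `[a, b]` is, up to reparametrisation, the composition of the letters of the word
(edges of `Γ` and their inverses). -/
def FollowsWord (Γ : Graph d k Sig) (c : ℝ → Sig) (b : ℝ) :
    ℝ → List (Fin Γ.card × Bool) → Prop
  | a, [] => a = b
  | a, l :: w => ∃ m, a < m ∧ m ≤ b ∧ IsReparam c a m (letterCurve Γ l) ∧ FollowsWord Γ c b m w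

/-- The edge `c` is the path in `Γ` that is given by the word `w`. -/
def Edge.IsPath (c : Edge d k Sig) (Γ : Graph d k Sig) (w : List (Fin Γ.card × Bool)) : Prop :=
  FollowsWord Γ c.toFun 1 0 w

/-- `Γ'` is a subgraph of `Γ`: its (independent) edges are paths in `Γ`. -/
def IsSubgraph (Γ' Γ : Graph d k Sig) : Prop :=
  ∀ e, ∃ w, (Γ'.edge e).IsPath Γ w

/-- The finite graph system of `Γ`: all its subgraphs. -/
def graphSystem (Γ : Graph d k Sig) : Set (Graph d k Sig) := {Γ' | IsSubgraph Γ' Γ}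

/-- The order on finite graph systems. -/
def GraphSystemLE (Γ' Γ : Graph d k Sig) : Prop :=
  graphSystem Γ' ⊆ graphSystem Γ ∧ IsSubgraph Γ' Γ

/-- The surface intersection property of the graph `Γ` for the set `S` of surfaces: every edge
`e` has a surface `σ e` of its own in `S`, which it meets exactly once, and this in its source or
in its target; it meets no other surface of `S`, and no other edge meets `σ e`. (Surfaces with
the same underlying set, such as the two co-orientations of a surface, are not told apart.) -/
def HasSIP (S : Set (Surface d k Sig)) (Γ : Graph d k Sig) : Prop :=
  ∃ σ : Fin Γ.card → Surface d k Sig, (∀ e, σ e ∈ S) ∧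
    (∀ e, ∃ t₀ : ℝ, (t₀ = 0 ∨ t₀ = 1) ∧
      ∀ t ∈ Icc (0 : ℝ) 1, (Γ.edge e).toFun t ∈ (σ e).carrier ↔ t = t₀) ∧
    (∀ e, ∀ s ∈ S, (∃ t ∈ Icc (0 : ℝ) 1, (Γ.edge e).toFun t ∈ s.carrier) →
      s.carrier = (σ e).carrier) ∧
    (∀ e f, e ≠ f → ∀ t ∈ Icc (0 : ℝ) 1, (Γ.edge f).toFun t ∉ (σ e).carrier)

open Classical in
/-- `+1` if `c` is outgoing and lies above `s` (near its source), `-1` if it is outgoing and lies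
below `s`, `0` if it is not outgoing. -/
def iotaL (s : Surface d k Sig) (c : Edge d k Sig) : ℤ :=
  if c.toFun 0 ∈ s.carrier ∧ ∀ᶠ t in 𝓝[>] (0 : ℝ), c.toFun t ∈ s.above then 1
  else if c.toFun 0 ∈ s.carrier ∧ ∀ᶠ t in 𝓝[>] (0 : ℝ), c.toFun t ∈ s.below then -1
  else 0

open Classical in
/-- `-1` if `c` is ingoing and lies above `s` (near its target), `+1` if it is ingoing and lies
below `s`, `0` if it is not ingoing. -/
def iotaR (s : Surface d k Sig) (c : Edge d k Sig) : ℤ :=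
  if c.toFun 1 ∈ s.carrier ∧ ∀ᶠ t in 𝓝[<] (1 : ℝ), c.toFun t ∈ s.above then -1
  else if c.toFun 1 ∈ s.carrier ∧ ∀ᶠ t in 𝓝[<] (1 : ℝ), c.toFun t ∈ s.below then 1
  else 0

end Geometry

/-! ### Configuration spaces and fluxes -/

section Config

variable {d : ℕ} {k : WithTop ℕ∞} {Sig : Type*} [TopologicalSpace Sig]
  [ChartedSpace (EuclideanSpace ℝ (Fin d)) Sig]

/-- The configuration space of a graph with `N` edges, identified with the group `G ^ N` by
evaluating holonomies on the edges. -/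
def GraphConn (Γ : Graph d k Sig) (G : Type*) : Type _ := Fin Γ.card → G

variable (Γ : Graph d k Sig) (G : Type*) [Group G] [TopologicalSpace G]

instance : Group (GraphConn Γ G) := inferInstanceAs (Group (Fin Γ.card → G))
instance : TopologicalSpace (GraphConn Γ G) :=
  inferInstanceAs (TopologicalSpace (Fin Γ.card → G))
instance [IsTopologicalGroup G] : IsTopologicalGroup (GraphConn Γ G) :=
  inferInstanceAs (IsTopologicalGroup (Fin Γ.card → G))
instance [CompactSpace G] : CompactSpace (GraphConn Γ G) :=
  inferInstanceAs (CompactSpace (Fin Γ.card → G))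
instance [T2Space G] : T2Space (GraphConn Γ G) := inferInstanceAs (T2Space (Fin Γ.card → G))
instance : MeasurableSpace (GraphConn Γ G) := borel _
instance : BorelSpace (GraphConn Γ G) := ⟨rfl⟩

/-- The normalised Haar measure of the compact group `G ^ N`. -/
def graphHaar [IsTopologicalGroup G] [CompactSpace G] : Measure (GraphConn Γ G) :=
  Measure.haarMeasure ⊤

variable {Γ G}

/-- The holonomy along a path, given the holonomies along the edges. -/
def hol (h : GraphConn Γ G) (w : List (Fin Γ.card × Bool)) : G :=
  (w.map fun l => if l.2 then h l.1 else (h l.1)⁻¹).prod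

variable (Γ G)

/-- The elementary flux of the surface `s` with the group elements `a` (left) and `b` (right),
evaluated on the edges of `Γ`. -/
def elementaryFlux {G : Type*} [Group G] (s : Surface d k Sig) (a b : G) : Fin Γ.card → G × G :=
  fun e => (a ^ iotaL s (Γ.edge e), b ^ iotaR s (Γ.edge e))

/-- The flux group of the set `S` of surfaces and the graph `Γ`: all finite products of elementary
fluxes. (Reversing the co-orientation of `s` replaces `a, b` by their inverses and yields nothing
new; the inverse of an elementary flux is elementary.) -/
def fluxGroup (S : Set (Surface d k Sig)) : Subgroup (Fin Γ.card → G × G) :=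
  Subgroup.closure {ρ | ∃ s ∈ S, ∃ a b : G, ρ = elementaryFlux Γ s a b}

end Config

/-! ### The limit of a sequence of graphs -/

section Limit

variable {d : ℕ} {k : WithTop ℕ∞} {Sig : Type*} [TopologicalSpace Sig]
  [ChartedSpace (EuclideanSpace ℝ (Fin d)) Sig]
  (Γ : ℕ → Graph d k Sig) (G : Type*) [Group G]

/-- The finite graph system of the limit: the union of the graph systems of the family. -/
def limitGraphSystem : Set (Graph d k Sig) := ⋃ i, graphSystem (Γ i)

/-- Compatible families of configurations: if `Γ i` is a subgraph of `Γ j`, the configuration on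
`Γ i` consists of the holonomies of the configuration on `Γ j`. -/
def Compatible {G : Type*} [Group G] (h : ∀ i, GraphConn (Γ i) G) : Prop :=
  ∀ i j, IsSubgraph (Γ i) (Γ j) → ∀ e w, ((Γ i).edge e).IsPath (Γ j) w → h i e = hol (h j) w

/-- The configuration space of the limit: the projective limit of the configuration spaces. -/
def LimitConn : Type _ := {h : ∀ i, GraphConn (Γ i) G // Compatible Γ h}

instance [TopologicalSpace G] : TopologicalSpace (LimitConn Γ G) :=
  inferInstanceAs (TopologicalSpace {h : ∀ i, GraphConn (Γ i) G // Compatible Γ h})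
instance [TopologicalSpace G] : MeasurableSpace (LimitConn Γ G) := borel _
instance [TopologicalSpace G] : BorelSpace (LimitConn Γ G) := ⟨rfl⟩

/-- The projection to the `i`-th configuration space. -/
def proj [TopologicalSpace G] (i : ℕ) : C(LimitConn Γ G, GraphConn (Γ i) G) where
  toFun h := h.1 i
  continuous_toFun := (continuous_apply i).comp continuous_subtype_val

variable {G} in
/-- The inclusion of the functions on the `i`-th configuration space. -/
def beta [TopologicalSpace G] (i : ℕ) (f : C(GraphConn (Γ i) G, ℂ)) : C(LimitConn Γ G, ℂ) :=
  f.comp (proj Γ G i)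

/-- Translation of a family of configurations by a family of fluxes. -/
def translate {Γ : ℕ → Graph d k Sig} {G : Type*} [Group G] (ρ : ∀ i, Fin (Γ i).card → G × G)
    (h : ∀ i, GraphConn (Γ i) G) : ∀ i, GraphConn (Γ i) G :=
  fun i e => (ρ i e).1 * h i e * (ρ i e).2⁻¹

lemma translate_one (h : ∀ i, GraphConn (Γ i) G) : translate 1 h = h := by
  funext i e; simp [translate]

lemma translate_mul (ρ ρ' : ∀ i, Fin (Γ i).card → G × G) (h : ∀ i, GraphConn (Γ i) G) :
    translate (ρ * ρ') h = translate ρ (translate ρ' h) := by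
  funext i e; simp [translate, mul_assoc]

/-- The flux group of the limit: families of elements of the flux groups of the graphs whose
translations are compatible with each other, that is, preserve the compatible families. -/
def limitFluxGroup (S : Set (Surface d k Sig)) : Subgroup (∀ i, Fin (Γ i).card → G × G) where
  carrier := {ρ | (∀ i, ρ i ∈ fluxGroup (Γ i) G S) ∧
    ∀ h : ∀ i, GraphConn (Γ i) G, Compatible Γ (translate ρ h) ↔ Compatible Γ h}
  one_mem' := ⟨fun i => one_mem _, fun h => by rw [translate_one]⟩
  mul_mem' := fun {a b} ha hb => ⟨fun i => mul_mem (ha.1 i) (hb.1 i), fun h => by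
    rw [translate_mul, ha.2, hb.2]⟩
  inv_mem' := fun {a} ha => ⟨fun i => inv_mem (ha.1 i), fun h => by
    rw [← ha.2, ← translate_mul, mul_inv_cancel, translate_one]⟩

/-- The action of the flux group on the configuration space of the limit. -/
instance (S : Set (Surface d k Sig)) : MulAction (limitFluxGroup Γ G S) (LimitConn Γ G) where
  smul ρ h := ⟨translate ρ.1 h.1, (ρ.2.2 h.1).2 h.2⟩
  one_smul h := Subtype.ext (translate_one Γ G h.1)
  mul_smul ρ ρ' h := Subtype.ext (translate_mul Γ G ρ.1 ρ'.1 h.1)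

instance (S : Set (Surface d k Sig)) [TopologicalSpace G] [IsTopologicalGroup G] :
    ContinuousConstSMul (limitFluxGroup Γ G S) (LimitConn Γ G) where
  continuous_const_smul ρ := by
    refine Continuous.subtype_mk (continuous_pi fun i => continuous_pi fun e => ?_) _
    have h1 : Continuous fun h : LimitConn Γ G => h.1 i e :=
      (continuous_apply e).comp ((continuous_apply i).comp continuous_subtype_val)
    exact (continuous_const.mul h1).mul continuous_const

variable {Γ G} in
/-- The automorphic action of the flux group on functions, `(α ρ f) h = f (ρ⁻¹ • h)`. -/
def fluxAct {S : Set (Surface d k Sig)} [TopologicalSpace G] [IsTopologicalGroup G]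
    (ρ : limitFluxGroup Γ G S) (f : C(LimitConn Γ G, ℂ)) : C(LimitConn Γ G, ℂ) :=
  f.comp ⟨fun h => ρ⁻¹ • h, continuous_const_smul ρ⁻¹⟩

/-- The limit measure: the regular Borel measure whose marginals are the Haar measures. -/
def IsLimitHaar [TopologicalSpace G] [IsTopologicalGroup G] [CompactSpace G]
    (μ : Measure (LimitConn Γ G)) : Prop :=
  μ.Regular ∧ ∀ i, μ.map (proj Γ G i) = graphHaar (Γ i) G

end Limit

/-! ### The Weyl algebra and its states -/

section Weyl

variable {d : ℕ} {k : WithTop ℕ∞} {Sig : Type*} [TopologicalSpace Sig]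
  [ChartedSpace (EuclideanSpace ℝ (Fin d)) Sig]
  {Γ : ℕ → Graph d k Sig} {G : Type*} [Group G] [TopologicalSpace G]
  {μ : Measure (LimitConn Γ G)}

/-- `T` is the operator of multiplication by `f`. -/
def IsMulOp (f : C(LimitConn Γ G, ℂ)) (T : Lp ℂ 2 μ →L[ℂ] Lp ℂ 2 μ) : Prop :=
  ∀ ψ : Lp ℂ 2 μ, T ψ =ᵐ[μ] fun h => f h * ψ h

/-- `T` is the Weyl element of `ρ`, `(T ψ) h = ψ (ρ⁻¹ • h)`. -/
def IsWeylOp {S : Set (Surface d k Sig)} (ρ : limitFluxGroup Γ G S)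
    (T : Lp ℂ 2 μ →L[ℂ] Lp ℂ 2 μ) : Prop :=
  ∀ ψ : Lp ℂ 2 μ, T ψ =ᵐ[μ] fun h => ψ (ρ⁻¹ • h)

variable (μ) in
/-- The Weyl algebra of the set `SS` of surface sets: the C*-algebra of operators on `L²(μ)` that
is generated by the multiplications by continuous functions and by the Weyl elements of all
surface sets in `SS`. -/
def weylAlgebra (SS : Set (Set (Surface d k Sig))) : StarSubalgebra ℂ (Lp ℂ 2 μ →L[ℂ] Lp ℂ 2 μ) :=
  (StarAlgebra.adjoin ℂ ({T | ∃ f : C(LimitConn Γ G, ℂ), IsMulOp f T} ∪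
    {T | ∃ S ∈ SS, ∃ ρ : limitFluxGroup Γ G S, IsWeylOp ρ T})).topologicalClosure

end Weyl

/-- States on a unital *-algebra. -/
def states (A : Type*) [Ring A] [StarRing A] [Algebra ℂ A] : Set (A →ₗ[ℂ] ℂ) :=
  {om | om 1 = 1 ∧ ∀ a, (om (star a * a)).im = 0 ∧ 0 ≤ (om (star a * a)).re}

/-- Pure states: the extreme points of the set of states. -/
def pureStates (A : Type*) [Ring A] [StarRing A] [Algebra ℂ A] : Set (A →ₗ[ℂ] ℂ) :=
  (states A).extremePoints ℝ

end HolonomyFlux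

end

/-! The fluxes of the limit act on each $G^{N_i}$ by enough translations to single out Haar measure,
and by few enough to preserve it.

Enough: take a surface of $\breve S$ and opposite group elements $x, x^{-1}$. Reversing an edge then
exchanges and negates its two flux exponents consistently. When a path is cut into edges, the
junctions lie off the surface, since by the intersection property edges meet surfaces in end points
only. The translated holonomy therefore telescopes (`FollowsWord.hol_fluxShift`), and the flux
belongs to the limit group. Using the surface that belongs to one edge, such fluxes multiply that
coordinate alone, on a fixed side, by any element of $G$; products give all one-sided translations
of $G^{N_i}$ (`exists_smul_eq_sideMul`). By averaging, a normalised functional invariant under these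
is the Haar integral (`eq_integral_graphHaar`).

Few enough: every flux acts on each graph by a two-sided translation, which preserves Haar measure.
Hence the image of $\mu_j$ under the holonomy map of a subgraph is flux invariant, so it is $\mu_i$
(`integral_graphHaar_eq_of_comp`). The Haar integrals thus define a functional on cylinder
functions; Hahn–Banach, Riesz and Stone–Weierstrass turn it into the unique limit measure, which all
fluxes preserve.

For the state: if $\omega(u)=1$ for a unitary $u$, then $\omega((u-1)^*(u-1))=0$, so by
Cauchy–Schwarz $\omega(cu)=\omega(c)$. A state equal to one on the Weyl elements is therefore flux
invariant, hence the Haar integral on functions; since Weyl elements can be commuted to the right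
and absorbed, it is determined everywhere (`states.eq_of_weylElements`). Purity follows because $1$
is an extreme point of the unit disc (`mem_pureStates_of_unique`). -/

namespace HolonomyFlux

/-! ### Words in graphs: restriction, reversal, substitution -/

section Paths

variable {d : ℕ} {k : WithTop ℕ∞} {Sig : Type*} [TopologicalSpace Sig]
  [ChartedSpace (EuclideanSpace ℝ (Fin d)) Sig] {Γ Γ' Γ'' : Graph d k Sig}

lemma FollowsWord.le {c : ℝ → Sig} {b : ℝ} :
    ∀ {w : List (Fin Γ.card × Bool)} {a : ℝ}, FollowsWord Γ c b a w → a ≤ b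
  | [], _, h => le_of_eq h
  | _ :: _, _, ⟨_, ham, hmb, _, _⟩ => ham.le.trans hmb

lemma FollowsWord.append {c : ℝ → Sig} {b m : ℝ} {v : List (Fin Γ.card × Bool)}
    (hv : FollowsWord Γ c b m v) :
    ∀ {u : List (Fin Γ.card × Bool)} {a : ℝ}, FollowsWord Γ c m a u →
      FollowsWord Γ c b a (u ++ v)
  | [], _, h => by cases h; exact hv
  | _ :: _, _, ⟨n, han, hnm, hr, hu⟩ => ⟨n, han, hnm.trans hv.le, hr, FollowsWord.append hv hu⟩

lemma FollowsWord.singleton {c : ℝ → Sig} {a b : ℝ} (hab : a < b) {l : Fin Γ.card × Bool}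
    (h : IsReparam c a b (letterCurve Γ l)) : FollowsWord Γ c b a [l] :=
  ⟨b, hab, le_rfl, h, rfl⟩

lemma FollowsWord.comp {g : ℝ → Sig} {b' : ℝ} {c : ℝ → Sig} {φ : ℝ → ℝ} {b : ℝ} :
    ∀ {w : List (Fin Γ.card × Bool)} {a' a : ℝ}, FollowsWord Γ g b' a' w → a ≤ b →
      ContinuousOn φ (Icc a b) → StrictMonoOn φ (Icc a b) → φ a = a' → φ b = b' →
      (∀ t ∈ Icc a b, c t = g (φ t)) → FollowsWord Γ c b a w
  | [], a', a, h, hab, _, hm, ha, hb, _ => by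
    have h : a' = b' := h
    exact hm.injOn (left_mem_Icc.2 hab) (right_mem_Icc.2 hab) (by rw [ha, hb, h])
  | l :: w, a', a, ⟨m', ham', hmb', ⟨ψ, hψc, hψm, hψ0, hψ1, hψ⟩, hw⟩, hab, hc, hm, ha, hb, he => by
    -- The intermediate value theorem pulls the end `m'` of the first letter back to a cutting point
    -- of the interval of `c`.
    obtain ⟨m, hmI, rfl⟩ : m' ∈ φ '' Icc a b :=
      intermediate_value_Icc hab hc (by rw [ha, hb]; exact ⟨ham'.le, hmb'⟩)
    have ham : a < m := (hm.lt_iff_lt (left_mem_Icc.2 hab) hmI).1 (by rwa [ha])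
    have hsub : Icc a m ⊆ Icc a b := Icc_subset_Icc_right hmI.2
    have hsub' : Icc m b ⊆ Icc a b := Icc_subset_Icc_left hmI.1
    have hmaps : MapsTo φ (Icc a m) (Icc a' (φ m)) := fun t ht =>
      ⟨by rw [← ha]; exact hm.monotoneOn (left_mem_Icc.2 hab) (hsub ht) ht.1,
        hm.monotoneOn (hsub ht) hmI ht.2⟩
    refine ⟨m, ham, hmI.2, ⟨ψ ∘ φ, hψc.comp (hc.mono hsub) hmaps,
      hψm.comp (hm.mono hsub) hmaps, by simp [ha, hψ0], by simp [hψ1], fun t ht => ?_⟩, ?_⟩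
    · rw [he t (hsub ht), hψ _ (hmaps ht), Function.comp_apply]
    · exact FollowsWord.comp hw hmI.2 (hc.mono hsub') (hm.mono hsub') rfl hb
        fun t ht => he t (hsub' ht)

lemma letterCurve_not (l : Fin Γ.card × Bool) (t : ℝ) :
    letterCurve Γ (l.1, !l.2) t = letterCurve Γ l (1 - t) := by
  obtain ⟨e, b⟩ := l
  cases b <;> simp [letterCurve]

lemma FollowsWord.reverse {g : ℝ → Sig} {b : ℝ} :
    ∀ {w : List (Fin Γ.card × Bool)} {a : ℝ}, FollowsWord Γ g b a w →
      ∃ w', FollowsWord Γ (fun t => g (1 - t)) (1 - a) (1 - b) w'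
  | [], _, h => by cases h; exact ⟨[], rfl⟩
  | l :: _, a, ⟨m, ham, _, ⟨φ, hc, hm, h0, h1, he⟩, hw⟩ => by
    obtain ⟨w', hw'⟩ := FollowsWord.reverse hw
    have hmaps : MapsTo (fun t : ℝ => 1 - t) (Icc (1 - m) (1 - a)) (Icc a m) := fun t ht =>
      ⟨by linarith [ht.2], by linarith [ht.1]⟩
    refine ⟨w' ++ [(l.1, !l.2)], FollowsWord.append (FollowsWord.singleton (by linarith) ?_) hw'⟩
    refine ⟨fun t => 1 - φ (1 - t), ?_, ?_, by simp [h1], by simp [h0], fun t ht => ?_⟩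
    · exact continuousOn_const.sub (hc.comp (by fun_prop) hmaps)
    · intro s hs t ht hst
      have := hm (hmaps ht) (hmaps hs) (by simpa using hst)
      simpa using this
    · rw [letterCurve_not, sub_sub_cancel]
      exact he _ (hmaps ht)

lemma IsSubgraph.letter (h : IsSubgraph Γ' Γ) (l : Fin Γ'.card × Bool) :
    ∃ w, FollowsWord Γ (letterCurve Γ' l) 1 0 w := by
  obtain ⟨e, b⟩ := l
  obtain ⟨w, hw⟩ := h e
  cases b
  · obtain ⟨w', hw'⟩ := FollowsWord.reverse hw
    refine ⟨w', ?_⟩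
    rw [sub_self, sub_zero] at hw'
    convert hw' using 2
    simp [letterCurve]
  · refine ⟨w, ?_⟩
    convert (show FollowsWord Γ (Γ'.edge e).toFun 1 0 w from hw) using 2
    ext; simp [letterCurve]

/-- Each letter is replaced by a word in the larger graph, reparametrised to the letter's interval,
and the words are concatenated. -/
lemma FollowsWord.of_isSubgraph (h : IsSubgraph Γ' Γ) {c : ℝ → Sig} {b : ℝ} :
    ∀ {w : List (Fin Γ'.card × Bool)} {a : ℝ}, FollowsWord Γ' c b a w →
      ∃ w', FollowsWord Γ c b a w'
  | [], _, hw => ⟨[], hw⟩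
  | l :: _, _, ⟨m, ham, _, ⟨φ, hc, hm, h0, h1, he⟩, hw⟩ => by
    obtain ⟨v, hv⟩ := FollowsWord.of_isSubgraph h hw
    obtain ⟨u, hu⟩ := h.letter l
    exact ⟨u ++ v, hv.append (hu.comp ham.le hc hm h0 h1 he)⟩

lemma IsSubgraph.trans (h : IsSubgraph Γ'' Γ') (h' : IsSubgraph Γ' Γ) : IsSubgraph Γ'' Γ :=
  fun e => (h e).elim fun _ hw => FollowsWord.of_isSubgraph h' hw

lemma graphSystemLE_iff : GraphSystemLE Γ' Γ ↔ IsSubgraph Γ' Γ :=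
  ⟨fun h => h.2, fun h => ⟨fun _ hΔ => IsSubgraph.trans hΔ h, h⟩⟩

lemma mem_limitGraphSystem_iff {Γ : ℕ → Graph d k Sig} {Δ : Graph d k Sig} :
    Δ ∈ limitGraphSystem Γ ↔ ∃ i, GraphSystemLE Δ (Γ i) := by
  simp only [limitGraphSystem, mem_iUnion, graphSystemLE_iff]
  rfl

end Paths

/-! ### One-sided neighbourhoods under reparametrisation -/

section OneSidedGerms

/-- By the intermediate value theorem, a continuous strictly increasing map carries small right
neighbourhoods onto right neighbourhoods. Position relative to a surface is thus independent of the
parametrisation. -/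
lemma eventually_nhdsGT_comp_iff {φ : ℝ → ℝ} {a m : ℝ} (ham : a < m)
    (hc : ContinuousOn φ (Icc a m)) (hm : StrictMonoOn φ (Icc a m)) {P : ℝ → Prop} :
    (∀ᶠ t in 𝓝[>] a, P (φ t)) ↔ ∀ᶠ u in 𝓝[>] (φ a), P u := by
  have haI : a ∈ Icc a m := left_mem_Icc.2 ham.le
  refine ⟨fun h => ?_, fun h => ?_⟩
  · obtain ⟨u, hu, hsub⟩ := (mem_nhdsGT_iff_exists_Ioo_subset' ham).1 h
    have ham' : a < min u m := lt_min hu ham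
    have hI : min u m ∈ Icc a m := ⟨ham'.le, min_le_right _ _⟩
    filter_upwards [Ioo_mem_nhdsGT (hm haI hI ham')] with v hv
    obtain ⟨t, ht, rfl⟩ := intermediate_value_Icc ham'.le
      (hc.mono (Icc_subset_Icc_right hI.2)) (Ioo_subset_Icc_self hv)
    have htI : t ∈ Icc a m := ⟨ht.1, ht.2.trans hI.2⟩
    exact hsub ⟨(hm.lt_iff_lt haI htI).1 hv.1,
      ((hm.lt_iff_lt htI hI).1 hv.2).trans_le (min_le_left _ _)⟩
  · have : Filter.Tendsto φ (𝓝[>] a) (𝓝[>] (φ a)) := by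
      rw [← nhdsWithin_Ioc_eq_nhdsGT ham]
      refine tendsto_nhdsWithin_iff.2 ⟨(hc a haI).mono Ioc_subset_Icc_self, ?_⟩
      filter_upwards [self_mem_nhdsWithin] with t ht
      exact hm haI (Ioc_subset_Icc_self ht) ht.1
    exact this.eventually h

lemma eventually_nhdsLT_comp_iff {φ : ℝ → ℝ} {a m : ℝ} (ham : a < m)
    (hc : ContinuousOn φ (Icc a m)) (hm : StrictMonoOn φ (Icc a m)) {P : ℝ → Prop} :
    (∀ᶠ t in 𝓝[<] m, P (φ t)) ↔ ∀ᶠ u in 𝓝[<] (φ m), P u := by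
  have hmI : m ∈ Icc a m := right_mem_Icc.2 ham.le
  refine ⟨fun h => ?_, fun h => ?_⟩
  · obtain ⟨u, hu, hsub⟩ := (mem_nhdsLT_iff_exists_Ioo_subset' ham).1 h
    have ham' : max u a < m := max_lt hu ham
    have hI : max u a ∈ Icc a m := ⟨le_max_right _ _, ham'.le⟩
    filter_upwards [Ioo_mem_nhdsLT (hm hI hmI ham')] with v hv
    obtain ⟨t, ht, rfl⟩ := intermediate_value_Icc ham'.le
      (hc.mono (Icc_subset_Icc_left hI.1)) (Ioo_subset_Icc_self hv)
    have htI : t ∈ Icc a m := ⟨hI.1.trans ht.1, ht.2⟩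
    exact hsub ⟨(le_max_left _ _).trans_lt ((hm.lt_iff_lt hI htI).1 hv.1),
      (hm.lt_iff_lt htI hmI).1 hv.2⟩
  · have : Filter.Tendsto φ (𝓝[<] m) (𝓝[<] (φ m)) := by
      rw [← nhdsWithin_Ico_eq_nhdsLT ham]
      refine tendsto_nhdsWithin_iff.2 ⟨(hc m hmI).mono Ico_subset_Icc_self, ?_⟩
      filter_upwards [self_mem_nhdsWithin] with t ht
      exact hm (Ico_subset_Icc_self ht) hmI ht.2
    exact this.eventually h

lemma eventually_nhdsGT_one_sub_iff {P : ℝ → Prop} {x : ℝ} :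
    (∀ᶠ t in 𝓝[>] x, P (1 - t)) ↔ ∀ᶠ t in 𝓝[<] (1 - x), P t := by
  have h1 : Filter.Tendsto (fun t : ℝ => 1 - t) (𝓝[>] x) (𝓝[<] (1 - x)) := by
    refine tendsto_nhdsWithin_iff.2 ⟨((continuous_const.sub continuous_id).tendsto x).mono_left
      nhdsWithin_le_nhds, ?_⟩
    filter_upwards [self_mem_nhdsWithin] with t ht
    exact sub_lt_sub_left (show x < t from ht) (1 : ℝ)
  have h2 : Filter.Tendsto (fun t : ℝ => 1 - t) (𝓝[<] (1 - x)) (𝓝[>] x) := by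
    refine tendsto_nhdsWithin_iff.2 ⟨?_, ?_⟩
    · have := ((continuous_const.sub continuous_id).tendsto (1 - x) :
        Filter.Tendsto (fun t : ℝ => 1 - t) _ _)
      exact (this.mono_left nhdsWithin_le_nhds).trans_eq (by simp)
    · filter_upwards [self_mem_nhdsWithin] with t ht
      have : t < 1 - x := ht
      exact lt_sub_comm.1 this
  exact ⟨fun h => by simpa using h2.eventually h, fun h => h1.eventually h⟩

end OneSidedGerms

/-! ### Translation of holonomies by fluxes -/

section Flux

variable {d : ℕ} {k : WithTop ℕ∞} {Sig : Type*} [TopologicalSpace Sig]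
  [ChartedSpace (EuclideanSpace ℝ (Fin d)) Sig]

open Classical in
/-- The position of a curve relative to a surface immediately after the parameter `a`. -/
noncomputable def germL (s : Surface d k Sig) (c : ℝ → Sig) (a : ℝ) : ℤ :=
  if c a ∈ s.carrier ∧ ∀ᶠ t in 𝓝[>] a, c t ∈ s.above then 1
  else if c a ∈ s.carrier ∧ ∀ᶠ t in 𝓝[>] a, c t ∈ s.below then -1
  else 0

open Classical in
/-- The position of a curve relative to a surface immediately before the parameter `b`, with
reversed sign. -/
noncomputable def germR (s : Surface d k Sig) (c : ℝ → Sig) (b : ℝ) : ℤ :=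
  if c b ∈ s.carrier ∧ ∀ᶠ t in 𝓝[<] b, c t ∈ s.above then -1
  else if c b ∈ s.carrier ∧ ∀ᶠ t in 𝓝[<] b, c t ∈ s.below then 1
  else 0

variable {s : Surface d k Sig} {c g : ℝ → Sig} {a b : ℝ}

lemma iotaL_eq_germL (e : Edge d k Sig) : iotaL s e = germL s e.toFun 0 := rfl

lemma iotaR_eq_germR (e : Edge d k Sig) : iotaR s e = germR s e.toFun 1 := rfl

lemma germL_eq_zero (h : c a ∉ s.carrier) : germL s c a = 0 := by simp [germL, h]

lemma germR_eq_zero (h : c b ∉ s.carrier) : germR s c b = 0 := by simp [germR, h]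

open Classical in
lemma germL_one_sub : germL s (fun t => c (1 - t)) 0 = -germR s c 1 := by
  have h (A : Set Sig) := eventually_nhdsGT_one_sub_iff (P := fun t => c t ∈ A) (x := 0)
  simp only [sub_zero] at h
  have h0 : c (1 - 0) ∈ s.carrier ↔ c 1 ∈ s.carrier := by rw [sub_zero]
  rw [germL, germR, if_congr (and_congr h0 (h s.above)) rfl
    (if_congr (and_congr h0 (h s.below)) rfl rfl)]
  split_ifs <;> rfl

lemma germR_one_sub : germR s (fun t => c (1 - t)) 1 = -germL s c 0 := by
  rw [← neg_neg (germR s _ 1), ← germL_one_sub]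
  simp

open Classical in
lemma IsReparam.germL_eq (hab : a < b) (h : IsReparam c a b g) : germL s c a = germL s g 0 := by
  obtain ⟨φ, hc, hm, h0, h1, he⟩ := h
  have key (A : Set Sig) : (∀ᶠ t in 𝓝[>] a, c t ∈ A) ↔ ∀ᶠ t in 𝓝[>] (0 : ℝ), g t ∈ A := by
    rw [← h0, ← eventually_nhdsGT_comp_iff (P := fun t => g t ∈ A) hab hc hm]
    refine Filter.eventually_congr ?_
    filter_upwards [Ioo_mem_nhdsGT hab] with t ht
    rw [he t (Ioo_subset_Icc_self ht)]
  have ha : c a ∈ s.carrier ↔ g 0 ∈ s.carrier := by rw [he a (left_mem_Icc.2 hab.le), h0]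
  exact if_congr (and_congr ha (key _)) rfl (if_congr (and_congr ha (key _)) rfl rfl)

open Classical in
lemma IsReparam.germR_eq (hab : a < b) (h : IsReparam c a b g) : germR s c b = germR s g 1 := by
  obtain ⟨φ, hc, hm, h0, h1, he⟩ := h
  have key (A : Set Sig) : (∀ᶠ t in 𝓝[<] b, c t ∈ A) ↔ ∀ᶠ t in 𝓝[<] (1 : ℝ), g t ∈ A := by
    rw [← h1, ← eventually_nhdsLT_comp_iff (P := fun t => g t ∈ A) hab hc hm]
    refine Filter.eventually_congr ?_
    filter_upwards [Ioo_mem_nhdsLT hab] with t ht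
    rw [he t (Ioo_subset_Icc_self ht)]
  have hb : c b ∈ s.carrier ↔ g 1 ∈ s.carrier := by rw [he b (right_mem_Icc.2 hab.le), h1]
  exact if_congr (and_congr hb (key _)) rfl (if_congr (and_congr hb (key _)) rfl rfl)

variable {G : Type*} [Group G]

/-- The translation by the elementary flux with opposite group elements. -/
noncomputable def fluxShift (Γ : Graph d k Sig) (s : Surface d k Sig) (x : G)
    (h : GraphConn Γ G) : GraphConn Γ G :=
  fun e => (elementaryFlux Γ s x x⁻¹ e).1 * h e * (elementaryFlux Γ s x x⁻¹ e).2⁻¹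

lemma fluxShift_apply (Γ : Graph d k Sig) (s : Surface d k Sig) (x : G) (h : GraphConn Γ G)
    (e : Fin Γ.card) : fluxShift Γ s x h e =
      x ^ germL s (Γ.edge e).toFun 0 * h e * x ^ germR s (Γ.edge e).toFun 1 := by
  simp [fluxShift, elementaryFlux, iotaL_eq_germL, iotaR_eq_germR]

lemma hol_cons {Γ : Graph d k Sig} (h : GraphConn Γ G) (l : Fin Γ.card × Bool)
    (w : List (Fin Γ.card × Bool)) :
    hol h (l :: w) = (if l.2 then h l.1 else (h l.1)⁻¹) * hol h w := by
  simp [hol]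

/-- This is where opposite group elements matter: inverting $x^l h x^r$ gives $x^{-r}h^{-1}x^{-l}$,
and reversing the curve exchanges the two germs with a change of sign. -/
lemma fluxShift_letter (Γ : Graph d k Sig) (s : Surface d k Sig) (x : G) (h : GraphConn Γ G)
    (l : Fin Γ.card × Bool) :
    (if l.2 then fluxShift Γ s x h l.1 else (fluxShift Γ s x h l.1)⁻¹) =
      x ^ germL s (letterCurve Γ l) 0 * (if l.2 then h l.1 else (h l.1)⁻¹) *
        x ^ germR s (letterCurve Γ l) 1 := by
  obtain ⟨e, b⟩ := l
  cases b
  · have hl : letterCurve Γ (e, false) = fun t => (Γ.edge e).toFun (1 - t) := by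
      ext; simp [letterCurve]
    simp [hl, fluxShift_apply, germL_one_sub, germR_one_sub, mul_assoc]
  · have hl : letterCurve Γ (e, true) = (Γ.edge e).toFun := by
      ext; simp [letterCurve]
    simp [hl, fluxShift_apply]

/-- The product over the letters telescopes: a junction lies inside the open interval, hence off the
surface, so both germs there vanish and only the factors at the two ends survive. -/
lemma FollowsWord.hol_fluxShift {Γ : Graph d k Sig} (x : G) (h : GraphConn Γ G) :
    ∀ {w : List (Fin Γ.card × Bool)} {a : ℝ}, a < b → FollowsWord Γ c b a w →
      (∀ t ∈ Ioo a b, c t ∉ s.carrier) →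
      hol (fluxShift Γ s x h) w = x ^ germL s c a * hol h w * x ^ germR s c b
  | [], _, hab, hw, _ => absurd hw hab.ne
  | l :: w, a, hab, ⟨m, ham, hmb, hr, hw⟩, hs => by
    rw [hol_cons, hol_cons, fluxShift_letter, ← hr.germL_eq ham, ← hr.germR_eq ham]
    rcases hmb.eq_or_lt with rfl | hmb
    -- The first letter already fills the interval, and any further letter would need positive
    -- length.
    · have : w = [] := by
        cases w with
        | nil => rfl
        | cons l' w' =>
          obtain ⟨m', h1, h2, -⟩ := hw
          exact absurd h2 (not_le.2 h1)
      subst this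
      simp [hol]
    · have hm := hs m ⟨ham, hmb⟩
      rw [FollowsWord.hol_fluxShift x h hmb hw fun t ht => hs t ⟨ham.trans ht.1, ht.2⟩,
        germL_eq_zero hm, germR_eq_zero hm]
      simp [mul_assoc]

/-- Near `c a` the surface is a zero set of a continuous function, which has no zero along the curve
just after `a`; by the intermediate value theorem its sign there is constant. -/
lemma Surface.above_or_below (s : Surface d k Sig) {c : ℝ → Sig}
    (hc : ContinuousWithinAt c (Ici a) a) {b : ℝ} (hab : a < b) (hc' : ContinuousOn c (Ioo a b))
    (ha : c a ∈ s.carrier) (hs : ∀ t ∈ Ioo a b, c t ∉ s.carrier) :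
    (∀ᶠ t in 𝓝[>] a, c t ∈ s.above) ∨ ∀ᶠ t in 𝓝[>] a, c t ∈ s.below := by
  obtain ⟨W, hWo, haW, φ, hφ, -, hW⟩ := s.locally_regular _ ha
  have hev : ∀ᶠ t in 𝓝[>] a, c t ∈ W :=
    (hc.mono Ioi_subset_Ici_self).eventually (hWo.mem_nhds haW)
  obtain ⟨u, hu, hsub⟩ := (mem_nhdsGT_iff_exists_Ioo_subset' hab).1 hev
  have hlt : a < min u b := lt_min hu hab
  have hI : Ioo a (min u b) ⊆ Ioo a b := Ioo_subset_Ioo_right (min_le_right _ _)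
  have hIW : MapsTo c (Ioo a (min u b)) W := fun t ht =>
    hsub (Ioo_subset_Ioo_right (min_le_left _ _) ht)
  have hcont : ContinuousOn (φ ∘ c) (Ioo a (min u b)) :=
    hφ.continuousOn.comp (hc'.mono hI) hIW
  have hne : ∀ t ∈ Ioo a (min u b), φ (c t) ≠ 0 := fun t ht h0 =>
    hs t (hI ht) ((hW _ (hIW ht)).1.2 h0)
  have hIoo := Ioo_mem_nhdsGT hlt
  by_cases hpos : ∀ t ∈ Ioo a (min u b), 0 < φ (c t)
  · left
    filter_upwards [hIoo] with t ht
    exact (hW _ (hIW ht)).2.1.2 (hpos t ht)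
  · right
    push Not at hpos
    obtain ⟨t₀, ht₀, h0⟩ := hpos
    filter_upwards [hIoo] with t ht
    refine (hW _ (hIW ht)).2.2.2 (not_le.1 fun hle => ?_)
    obtain ⟨t', ht', h'⟩ := isPreconnected_Ioo.intermediate_value ht₀ ht hcont ⟨h0, hle⟩
    exact hne t' ht' h'

lemma germL_eq_one_or (hab : a < b) (hc : ContinuousOn c (Icc a b))
    (ha : c a ∈ s.carrier) (hs : ∀ t ∈ Ioo a b, c t ∉ s.carrier) :
    germL s c a = 1 ∨ germL s c a = -1 := by
  have hca : ContinuousWithinAt c (Ici a) a :=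
    (hc a (left_mem_Icc.2 hab.le)).mono_of_mem_nhdsWithin (Icc_mem_nhdsGE hab)
  have := s.above_or_below hca hab (hc.mono Ioo_subset_Icc_self) ha hs
  unfold germL
  split_ifs with h1 h2
  · exact Or.inl rfl
  · exact Or.inr rfl
  · exact absurd this (not_or.2 ⟨fun h => h1 ⟨ha, h⟩, fun h => h2 ⟨ha, h⟩⟩)

lemma germR_eq_one_or (hc : ContinuousOn c (Icc 0 1))
    (ha : c 1 ∈ s.carrier) (hs : ∀ t ∈ Ioo (0 : ℝ) 1, c t ∉ s.carrier) :
    germR s c 1 = 1 ∨ germR s c 1 = -1 := by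
  have hm : MapsTo (fun t : ℝ => 1 - t) (Icc 0 1) (Icc 0 1) := fun t ht =>
    ⟨by linarith [ht.2], by linarith [ht.1]⟩
  have := germL_eq_one_or (s := s) (c := fun t => c (1 - t)) one_pos
    (hc.comp (by fun_prop) hm) (by simpa using ha)
    fun t ht => hs _ ⟨by linarith [ht.2], by linarith [ht.1]⟩
  rw [germL_one_sub] at this
  omega

/-! ### The flux group of the limit acts by one-sided translations -/

variable {Γ : ℕ → Graph d k Sig} {S : Set (Surface d k Sig)}

/-- A surface of `S` that the edge meets has the same carrier as the edge's own surface, which is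
met in an end point only. -/
lemma HasSIP.notMem_carrier {Γ : Graph d k Sig} (h : HasSIP S Γ) (hs : s ∈ S) (e : Fin Γ.card)
    {t : ℝ} (ht : t ∈ Ioo (0 : ℝ) 1) : (Γ.edge e).toFun t ∉ s.carrier := by
  obtain ⟨σ, -, h1, h2, -⟩ := h
  intro hmem
  rw [h2 e s hs ⟨t, Ioo_subset_Icc_self ht, hmem⟩] at hmem
  obtain ⟨t₀, ht₀, h⟩ := h1 e
  have := (h t (Ioo_subset_Icc_self ht)).1 hmem
  rcases ht₀ with h0 | h0
  · exact ht.1.ne' (this.trans h0)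
  · exact ht.2.ne (this.trans h0)

lemma Compatible.fluxShift (hS : ∀ i, HasSIP S (Γ i)) (hs : s ∈ S) (x : G)
    {h : ∀ i, GraphConn (Γ i) G} (hh : Compatible Γ h) :
    Compatible Γ fun i => fluxShift (Γ i) s x (h i) := by
  intro i j hij e w hw
  change HolonomyFlux.fluxShift (Γ i) s x (h i) e = _
  rw [FollowsWord.hol_fluxShift x (h j) one_pos hw fun t ht => (hS i).notMem_carrier hs e ht,
    fluxShift_apply, hh i j hij e w hw]

lemma fluxShift_inv_fluxShift (Γ : Graph d k Sig) (x : G) (h : GraphConn Γ G) :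
    fluxShift Γ s x⁻¹ (fluxShift Γ s x h) = h := by
  funext e
  simp [fluxShift_apply, mul_assoc]

/-- The element of the flux group of the limit that is given by a surface and a pair of opposite
group elements. -/
noncomputable def limitFlux (hS : ∀ i, HasSIP S (Γ i)) (hs : s ∈ S) (x : G) :
    limitFluxGroup Γ G S :=
  ⟨fun i => elementaryFlux (Γ i) s x x⁻¹,
    fun i => Subgroup.subset_closure ⟨s, hs, x, x⁻¹, rfl⟩, fun h =>
      ⟨fun hh => by
        have := Compatible.fluxShift hS hs x⁻¹ hh
        convert this using 2 with i
        exact (fluxShift_inv_fluxShift (Γ i) x (h i)).symm,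
      fun hh => Compatible.fluxShift hS hs x hh⟩⟩

variable [TopologicalSpace G]

lemma proj_limitFlux_smul (hS : ∀ i, HasSIP S (Γ i)) (hs : s ∈ S) (x : G) (h : LimitConn Γ G)
    (i : ℕ) : proj Γ G i (limitFlux hS hs x • h) = fluxShift (Γ i) s x (proj Γ G i h) := rfl

omit [TopologicalSpace G] in
/-- Translation of `G ^ N`, from the left in the coordinates in `L` and from the right in the
others. -/
def sideMul {Γ : Graph d k Sig} (L : Fin Γ.card → Bool) (a x : GraphConn Γ G) : GraphConn Γ G :=
  fun e => if L e then a e * x e else x e * a e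

/-- The surface belonging to `e` has zero germs at all other edges and at one end of `e`, and germ
$\pm1$ at the other end. The side `l` depends only on whether that end is the source or the target.
-/
lemma exists_smul_single (hS : ∀ i, HasSIP S (Γ i)) (i : ℕ) (e : Fin (Γ i).card) :
    ∃ l : Bool, ∀ a : G, ∃ ρ : limitFluxGroup Γ G S, ∀ h : LimitConn Γ G,
      ∀ f, proj Γ G i (ρ • h) f = if f = e then
        (if l then a * proj Γ G i h f else proj Γ G i h f * a) else proj Γ G i h f := by
  obtain ⟨σ, hσ, h1, -, h3⟩ := hS i
  have hoff (a : G) (h : LimitConn Γ G) (f : Fin (Γ i).card) (hf : f ≠ e) :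
      proj Γ G i (limitFlux hS (hσ e) a • h) f = proj Γ G i h f := by
    rw [proj_limitFlux_smul, fluxShift_apply,
      germL_eq_zero (h3 e f hf.symm 0 (by simp)), germR_eq_zero (h3 e f hf.symm 1 (by simp))]
    simp
  have hcont := ((Γ i).edge e).continuousOn
  have hint : ∀ t ∈ Ioo (0 : ℝ) 1, ((Γ i).edge e).toFun t ∉ (σ e).carrier := fun t ht =>
    (hS i).notMem_carrier (hσ e) e ht
  obtain ⟨t₀, ht₀, hmeet⟩ := h1 e
  rcases ht₀ with rfl | rfl
  · have hR : germR (σ e) ((Γ i).edge e).toFun 1 = 0 :=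
      germR_eq_zero fun h => one_ne_zero ((hmeet 1 (by simp)).1 h)
    have hon (a : G) (h : LimitConn Γ G) : proj Γ G i (limitFlux hS (hσ e) a • h) e =
        a ^ germL (σ e) ((Γ i).edge e).toFun 0 * proj Γ G i h e := by
      rw [proj_limitFlux_smul, fluxShift_apply, hR]
      simp
    refine ⟨true, fun a => ?_⟩
    -- The exponent is $\pm1$ according to the co-orientation, so `a` or its inverse serves.
    obtain ⟨b, hb⟩ : ∃ b : G, b ^ germL (σ e) ((Γ i).edge e).toFun 0 = a := by
      rcases germL_eq_one_or one_pos hcont ((hmeet 0 (by simp)).2 rfl) hint with h | h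
      · exact ⟨a, by simp [h]⟩
      · exact ⟨a⁻¹, by simp [h]⟩
    refine ⟨limitFlux hS (hσ e) b, fun h f => ?_⟩
    by_cases hf : f = e
    · subst hf; rw [hon, hb]; simp
    · rw [hoff b h f hf, if_neg hf]
  · have hL : germL (σ e) ((Γ i).edge e).toFun 0 = 0 :=
      germL_eq_zero fun h => zero_ne_one ((hmeet 0 (by simp)).1 h)
    have hon (a : G) (h : LimitConn Γ G) : proj Γ G i (limitFlux hS (hσ e) a • h) e =
        proj Γ G i h e * a ^ germR (σ e) ((Γ i).edge e).toFun 1 := by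
      rw [proj_limitFlux_smul, fluxShift_apply, hL]
      simp
    refine ⟨false, fun a => ?_⟩
    obtain ⟨b, hb⟩ : ∃ b : G, b ^ germR (σ e) ((Γ i).edge e).toFun 1 = a := by
      rcases germR_eq_one_or hcont ((hmeet 1 (by simp)).2 rfl) hint with h | h
      · exact ⟨a, by simp [h]⟩
      · exact ⟨a⁻¹, by simp [h]⟩
    refine ⟨limitFlux hS (hσ e) b, fun h f => ?_⟩
    by_cases hf : f = e
    · subst hf; rw [hon, hb]; simp
    · rw [hoff b h f hf, if_neg hf]

lemma exists_smul_eq_sideMul (hS : ∀ i, HasSIP S (Γ i)) (i : ℕ) :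
    ∃ L : Fin (Γ i).card → Bool, ∀ a : GraphConn (Γ i) G, ∃ ρ : limitFluxGroup Γ G S,
      ∀ h : LimitConn Γ G, proj Γ G i (ρ • h) = sideMul L a (proj Γ G i h) := by
  choose L hL using exists_smul_single (G := G) hS i
  refine ⟨L, fun a => ?_⟩
  have key (F : Finset (Fin (Γ i).card)) : ∃ ρ : limitFluxGroup Γ G S, ∀ h : LimitConn Γ G,
      ∀ e, proj Γ G i (ρ • h) e =
        if e ∈ F then sideMul L a (proj Γ G i h) e else proj Γ G i h e := by
    induction F using Finset.induction_on with
    | empty => exact ⟨1, by simp⟩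
    | insert e F he ih =>
      obtain ⟨ρ, hρ⟩ := ih
      obtain ⟨ρ', hρ'⟩ := hL e (a e)
      refine ⟨ρ' * ρ, fun h f => ?_⟩
      rw [mul_smul, hρ']
      by_cases hf : f = e
      · subst hf
        simp [hρ, he, sideMul]
      · rw [if_neg hf, hρ]
        simp [hf]
  obtain ⟨ρ, hρ⟩ := key Finset.univ
  exact ⟨ρ, fun h => funext fun e => by simp [hρ]⟩

omit [TopologicalSpace G] in
lemma compatible_one : Compatible (G := G) Γ fun _ => 1 := by
  intro i j _ e w _
  have h (v : List (Fin (Γ j).card × Bool)) : hol (1 : GraphConn (Γ j) G) v = 1 := by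
    refine List.prod_eq_one fun y hy => ?_
    obtain ⟨l, -, rfl⟩ := List.mem_map.1 hy
    have : (1 : GraphConn (Γ j) G) l.1 = 1 := rfl
    simp [this]
  exact (h w).symm

/-- One-sided translations are transitive on $G^{N_i}$, so the orbit of the trivial configuration
already projects onto everything. -/
lemma proj_surjective (hS : ∀ i, HasSIP S (Γ i)) (i : ℕ) :
    Function.Surjective (proj Γ G i) := by
  intro x
  obtain ⟨L, hL⟩ := exists_smul_eq_sideMul (G := G) hS i
  obtain ⟨ρ, hρ⟩ := hL x
  let h₀ : LimitConn Γ G := ⟨_, compatible_one⟩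
  have h₀_apply (e) : proj Γ G i h₀ e = 1 := rfl
  refine ⟨ρ • h₀, (hρ h₀).trans (funext fun e => ?_)⟩
  simp [sideMul, h₀_apply]

end Flux

/-! ### Averaging an invariant functional -/

section Average

variable {X : Type*} [TopologicalSpace X] [CompactSpace X]

lemma _root_.ContinuousMap.integrable_of_compactSpace [MeasurableSpace X] [OpensMeasurableSpace X]
    {E : Type*} [NormedAddCommGroup E] (f : C(X, E)) (μ : Measure X) [IsFiniteMeasure μ] :
    Integrable f μ :=
  f.continuous.integrable_of_hasCompactSupport (HasCompactSupport.of_compactSpace f)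

/-- Integration of continuous functions as a continuous linear functional. -/
noncomputable def integralCLM [MeasurableSpace X] [OpensMeasurableSpace X] (μ : Measure X)
    [IsProbabilityMeasure μ] : C(X, ℂ) →L[ℂ] ℂ :=
  LinearMap.mkContinuous
    { toFun := fun f => ∫ x, f x ∂μ
      map_add' := fun f g =>
        integral_add (f.integrable_of_compactSpace μ) (g.integrable_of_compactSpace μ)
      map_smul' := fun c f => integral_smul c f } 1 fun f => by
    simpa using norm_integral_le_of_norm_le_const (μ := μ) (.of_forall f.norm_coe_le_norm)

lemma integralCLM_apply [MeasurableSpace X] [OpensMeasurableSpace X] (μ : Measure X)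
    [IsProbabilityMeasure μ] (f : C(X, ℂ)) : integralCLM μ f = ∫ x, f x ∂μ := rfl

/-- A functional that is invariant under a family of transformations is determined by the averages
over the family, if these are constant. -/
lemma eq_of_invariant_of_average {K : Type*} [TopologicalSpace K] [CompactSpace K]
    [MeasurableSpace K] [OpensMeasurableSpace K] (ν : Measure K) [IsProbabilityMeasure ν]
    (T : C(K × X, X)) (om : C(X, ℂ) →L[ℂ] ℂ) (hom : om 1 = 1) (f : C(X, ℂ)) (z : ℂ)
    (hinv : ∀ a, om (f.comp (T.curry a)) = om f) (havg : ∀ x, ∫ a, f (T (a, x)) ∂ν = z) :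
    om f = z := by
  -- The translates are integrated as a continuous curve in the Banach space `C(X, ℂ)`. The
  -- functional commutes with this Bochner integral, so no product measure or Fubini theorem enters.
  let F : C(K, C(X, ℂ)) := (f.comp T).curry
  have hint : Integrable F ν := F.integrable_of_compactSpace ν
  have h1 : ∫ a, F a ∂ν = z • (1 : C(X, ℂ)) := by
    ext x
    have := (ContinuousMap.evalCLM ℂ x : C(X, ℂ) →L[ℂ] ℂ).integral_comp_comm hint
    simp only [ContinuousMap.evalCLM_apply] at this
    rw [← this]
    simpa [F] using havg x
  have h2 := om.integral_comp_comm hint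
  have h3 : ∀ a, om (F a) = om f := hinv
  rw [h1, map_smul, hom] at h2
  simpa [h3] using h2

end Average

/-! ### Haar measure of $G^N$ and one-sided translations -/

section Haar

variable {d : ℕ} {k : WithTop ℕ∞} {Sig : Type*} [TopologicalSpace Sig]
  [ChartedSpace (EuclideanSpace ℝ (Fin d)) Sig] {Γ : Graph d k Sig} {G : Type*} [Group G]
  [TopologicalSpace G] [IsTopologicalGroup G] [CompactSpace G]

instance : IsProbabilityMeasure (graphHaar Γ G) := by
  constructor
  rw [graphHaar]
  simpa using Measure.haarMeasure_self (K₀ := (⊤ : TopologicalSpace.PositiveCompacts (GraphConn Γ G)))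

instance : (graphHaar Γ G).IsHaarMeasure := by unfold graphHaar; infer_instance

/-- The inversion of all coordinates in `L`. -/
def sideInv (L : Fin Γ.card → Bool) (a : GraphConn Γ G) : GraphConn Γ G :=
  fun e => if L e then (a e)⁻¹ else a e

omit [Group G] [IsTopologicalGroup G] [CompactSpace G] in
lemma GraphConn.continuous_apply (e : Fin Γ.card) : Continuous fun x : GraphConn Γ G => x e :=
  _root_.continuous_apply (A := fun _ : Fin Γ.card => G) e

omit [Group G] [IsTopologicalGroup G] [CompactSpace G] in
lemma GraphConn.continuous_of_apply {Y : Type*} [TopologicalSpace Y] {f : Y → GraphConn Γ G}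
    (h : ∀ e, Continuous fun y => f y e) : Continuous f :=
  continuous_pi (A := fun _ : Fin Γ.card => G) h

omit [CompactSpace G] in
lemma continuous_sideInv (L : Fin Γ.card → Bool) :
    Continuous (sideInv L : GraphConn Γ G → GraphConn Γ G) := by
  refine GraphConn.continuous_of_apply fun e => ?_
  have := GraphConn.continuous_apply (G := G) e
  cases h : L e <;> simp only [sideInv, h] <;> simp <;> fun_prop

omit [CompactSpace G] in
lemma continuous_sideMul (L : Fin Γ.card → Bool) :
    Continuous fun p : GraphConn Γ G × GraphConn Γ G => sideMul L p.1 p.2 := by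
  refine GraphConn.continuous_of_apply fun e => ?_
  have h1 := (GraphConn.continuous_apply (G := G) e).comp
    (continuous_fst (X := GraphConn Γ G) (Y := GraphConn Γ G))
  have h2 := (GraphConn.continuous_apply (G := G) e).comp
    (continuous_snd (X := GraphConn Γ G) (Y := GraphConn Γ G))
  cases h : L e <;> simp only [sideMul, h]
  · exact h2.mul h1
  · exact h1.mul h2

lemma eq_integral_sideInv (L : Fin Γ.card → Bool) (om : C(GraphConn Γ G, ℂ) →L[ℂ] ℂ)
    (hom : om 1 = 1) (f : C(GraphConn Γ G, ℂ))
    (hinv : ∀ a, om (f.comp ((ContinuousMap.mk _ (continuous_sideMul L)).curry a)) = om f) :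
    om f = ∫ a, f (sideInv L a) ∂(graphHaar Γ G) := by
  refine eq_of_invariant_of_average (graphHaar Γ G)
    ⟨fun p => sideMul L (sideInv L p.1) p.2, (continuous_sideMul L).comp
      (((continuous_sideInv L).comp continuous_fst).prodMk continuous_snd)⟩ om hom f _
    (fun a => hinv (sideInv L a)) fun x => ?_
  -- Replacing `a` by `b * a` cancels `x` on either side: $(xa)^{-1}x=a^{-1}$ for coordinates in
  -- `L`, and $x(x^{-1}a)=a$ for the others. Only left invariance of Haar measure is needed.
  let b : GraphConn Γ G := fun e => if L e then x e else (x e)⁻¹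
  rw [← integral_mul_left_eq_self _ b]
  congr 1 with a
  congr 1
  funext e
  have h : (b * a) e = b e * a e := rfl
  cases hL : L e <;> simp [sideMul, sideInv, h, hL, b, mul_assoc]

/-- Unimodularity comes from the averaging formula applied to the Haar integral itself, with all
coordinates translated from the left. -/
lemma integral_graphHaar_inv (f : C(GraphConn Γ G, ℂ)) :
    ∫ a, f a⁻¹ ∂(graphHaar Γ G) = ∫ a, f a ∂(graphHaar Γ G) := by
  have := eq_integral_sideInv (fun _ => true) (integralCLM (graphHaar Γ G))
    (by simp [integralCLM_apply]) f
    fun a => integral_mul_left_eq_self (μ := graphHaar Γ G) (fun x => f x) a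
  exact this.symm

lemma integral_graphHaar_mul_mul (f : C(GraphConn Γ G, ℂ)) (u v : GraphConn Γ G) :
    ∫ a, f (u * a * v) ∂(graphHaar Γ G) = ∫ a, f a ∂(graphHaar Γ G) := by
  rw [integral_mul_left_eq_self (μ := graphHaar Γ G) (fun x => f (x * v)) u,
    ← integral_graphHaar_inv f,
    ← integral_mul_left_eq_self (μ := graphHaar Γ G) (fun x => f x⁻¹) v⁻¹]
  refine (integral_graphHaar_inv (f.comp ⟨fun x => x * v, continuous_mul_const v⟩)).symm.trans ?_
  simp

/-- Haar integration is the only normalised functional that is invariant under one-sided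
translations of all coordinates. -/
lemma eq_integral_graphHaar (L : Fin Γ.card → Bool) (om : C(GraphConn Γ G, ℂ) →L[ℂ] ℂ)
    (hom : om 1 = 1)
    (hinv : ∀ a f, om (f.comp ((ContinuousMap.mk _ (continuous_sideMul L)).curry a)) = om f)
    (f : C(GraphConn Γ G, ℂ)) : om f = ∫ a, f a ∂(graphHaar Γ G) := by
  rw [eq_integral_sideInv L om hom f fun a => hinv a f]
  -- The Haar integral is itself invariant under one-sided translations, being two-sided
  -- translations by `u` and `v`; so it equals the same average as `om`.
  refine (eq_integral_sideInv L (integralCLM (graphHaar Γ G)) (by simp [integralCLM_apply]) f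
    fun a => ?_).symm
  let u : GraphConn Γ G := fun e => if L e then a e else 1
  let v : GraphConn Γ G := fun e => if L e then 1 else a e
  have key (x : GraphConn Γ G) : sideMul L a x = u * x * v := by
    funext e
    change _ = u e * x e * v e
    cases hL : L e <;> simp [sideMul, hL, u, v]
  refine Eq.trans ?_ (integral_graphHaar_mul_mul f u v)
  simp only [integralCLM_apply, ContinuousMap.comp_apply, ContinuousMap.curry_apply,
    ContinuousMap.coe_mk, key]

end Haar

/-! ### Cylinder functions and the limit measure -/

section Limit

variable {d : ℕ} {k : WithTop ℕ∞} {Sig : Type*} [TopologicalSpace Sig]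
  [ChartedSpace (EuclideanSpace ℝ (Fin d)) Sig] {Γ : ℕ → Graph d k Sig} {G : Type*} [Group G]
  [TopologicalSpace G]

lemma continuous_hol [IsTopologicalGroup G] {Γ : Graph d k Sig} (w : List (Fin Γ.card × Bool)) :
    Continuous fun h : GraphConn Γ G => hol h w := by
  induction w with
  | nil => exact continuous_const
  | cons l w ih =>
    simp only [hol_cons]
    refine Continuous.mul ?_ ih
    have := GraphConn.continuous_apply (G := G) l.1
    split_ifs
    · exact this
    · exact this.inv

instance [T2Space G] : T2Space (LimitConn Γ G) :=
  inferInstanceAs (T2Space {h : ∀ i, GraphConn (Γ i) G // Compatible Γ h})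

instance [IsTopologicalGroup G] [CompactSpace G] [T2Space G] : CompactSpace (LimitConn Γ G) := by
  have hcl : IsClosed {h : ∀ i, GraphConn (Γ i) G | Compatible Γ h} := by
    simp only [Compatible, ofPred_forall]
    refine isClosed_iInter fun i => isClosed_iInter fun j => isClosed_iInter fun _ =>
      isClosed_iInter fun e => isClosed_iInter fun w => isClosed_iInter fun _ => ?_
    exact isClosed_eq ((GraphConn.continuous_apply e).comp (continuous_apply i))
      ((continuous_hol w).comp (continuous_apply j))
  exact isCompact_iff_compactSpace.1 hcl.isCompact

instance : Nonempty (LimitConn Γ G) := ⟨⟨_, compatible_one⟩⟩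

lemma exists_comp_proj_eq [IsTopologicalGroup G] {i j : ℕ} (hij : IsSubgraph (Γ i) (Γ j)) :
    ∃ q : C(GraphConn (Γ j) G, GraphConn (Γ i) G), ∀ h, q (proj Γ G j h) = proj Γ G i h := by
  choose w hw using hij
  exact ⟨⟨fun h e => hol h (w e), GraphConn.continuous_of_apply fun e => continuous_hol (w e)⟩,
    fun h => funext fun e => (h.2 i j (fun e => ⟨w e, hw e⟩) e (w e) (hw e)).symm⟩

lemma exists_beta_eq_beta [IsTopologicalGroup G] {i j : ℕ} (hij : IsSubgraph (Γ i) (Γ j))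
    (f : C(GraphConn (Γ i) G, ℂ)) : ∃ g, beta Γ j g = beta Γ i f := by
  obtain ⟨q, hq⟩ := exists_comp_proj_eq (G := G) hij
  exact ⟨f.comp q, ContinuousMap.ext fun h => congrArg f (hq h)⟩

variable (Γ) in
/-- Pairs of graphs of the family are subgraphs of a third one. -/
def DirectedGraphs : Prop := ∀ i j, ∃ l, IsSubgraph (Γ i) (Γ l) ∧ IsSubgraph (Γ j) (Γ l)

lemma DirectedGraphs.exists_beta_beta [IsTopologicalGroup G] (hΓ : DirectedGraphs Γ) {i j : ℕ}
    (f : C(GraphConn (Γ i) G, ℂ)) (g : C(GraphConn (Γ j) G, ℂ)) :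
    ∃ l f' g', beta Γ l f' = beta Γ i f ∧ beta Γ l g' = beta Γ j g := by
  obtain ⟨l, hi, hj⟩ := hΓ i j
  obtain ⟨f', hf'⟩ := exists_beta_eq_beta hi f
  obtain ⟨g', hg'⟩ := exists_beta_eq_beta hj g
  exact ⟨l, f', g', hf', hg'⟩

/-- The cylinder functions: continuous functions that depend on one graph of the family only. -/
def cylinder [IsTopologicalGroup G] (hΓ : DirectedGraphs Γ) :
    StarSubalgebra ℂ C(LimitConn Γ G, ℂ) where
  carrier := ⋃ i, range (beta Γ i)
  mul_mem' := by
    simp only [mem_iUnion, mem_range]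
    rintro _ _ ⟨i, f, rfl⟩ ⟨j, g, rfl⟩
    obtain ⟨l, f', g', hf, hg⟩ := hΓ.exists_beta_beta f g
    exact ⟨l, f' * g', by rw [← hf, ← hg]; rfl⟩
  add_mem' := by
    simp only [mem_iUnion, mem_range]
    rintro _ _ ⟨i, f, rfl⟩ ⟨j, g, rfl⟩
    obtain ⟨l, f', g', hf, hg⟩ := hΓ.exists_beta_beta f g
    exact ⟨l, f' + g', by rw [← hf, ← hg]; rfl⟩
  algebraMap_mem' r := mem_iUnion.2 ⟨0, algebraMap ℂ _ r, rfl⟩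
  star_mem' := by
    simp only [mem_iUnion, mem_range]
    rintro _ ⟨i, f, rfl⟩
    exact ⟨i, star f, rfl⟩

lemma exists_beta_of_mem_cylinder [IsTopologicalGroup G] {hΓ : DirectedGraphs Γ}
    {F : C(LimitConn Γ G, ℂ)} (h : F ∈ cylinder hΓ) : ∃ i f, beta Γ i f = F := by
  simpa using mem_iUnion.1 h

lemma beta_mem_cylinder [IsTopologicalGroup G] (hΓ : DirectedGraphs Γ) {i : ℕ}
    (f : C(GraphConn (Γ i) G, ℂ)) : beta Γ i f ∈ cylinder hΓ :=
  mem_iUnion.2 ⟨i, f, rfl⟩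

section Compact

variable [IsTopologicalGroup G] [CompactSpace G] [T2Space G]

/-- Stone–Weierstrass: distinct points of the limit differ on some graph, where a Urysohn function
on the compact Hausdorff space $G^{N_i}$ separates them. -/
lemma dense_range_beta (hΓ : DirectedGraphs Γ) :
    Dense (⋃ i, range (beta (G := G) Γ i)) := by
  have hsep : (cylinder (G := G) hΓ).SeparatesPoints := by
    intro x y hxy
    obtain ⟨i, hi⟩ : ∃ i, proj Γ G i x ≠ proj Γ G i y := by
      by_contra! h
      exact hxy (Subtype.ext (funext h))
    obtain ⟨f, hf0, hf1, -⟩ := exists_continuous_zero_one_of_isClosed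
      (isClosed_singleton (x := proj Γ G i x)) (isClosed_singleton (x := proj Γ G i y))
      (by simpa using hi)
    refine ⟨_, ⟨beta Γ i ⟨fun z => (f z : ℂ), by fun_prop⟩, beta_mem_cylinder hΓ _, rfl⟩, ?_⟩
    have h0 := hf0 rfl
    have h1 := hf1 rfl
    simp [beta, h0, h1]
  have := ContinuousMap.starSubalgebra_topologicalClosure_eq_top_of_separatesPoints _ hsep
  have h2 : closure (cylinder (G := G) hΓ : Set C(LimitConn Γ G, ℂ)) = univ := by
    rw [← StarSubalgebra.topologicalClosure_coe, this]; rfl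
  exact dense_iff_closure_eq.2 h2

omit [IsTopologicalGroup G] [CompactSpace G] [T2Space G] in
lemma beta_injective {S : Set (Surface d k Sig)} (hS : ∀ i, HasSIP S (Γ i)) (i : ℕ) :
    Function.Injective (beta (G := G) Γ i) := by
  intro f g hfg
  ext x
  obtain ⟨h, rfl⟩ := proj_surjective hS i x
  exact DFunLike.congr_fun hfg h

lemma norm_beta {S : Set (Surface d k Sig)} (hS : ∀ i, HasSIP S (Γ i)) (i : ℕ)
    (f : C(GraphConn (Γ i) G, ℂ)) : ‖beta Γ i f‖ = ‖f‖ := by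
  refine le_antisymm ((ContinuousMap.norm_le _ (norm_nonneg _)).2 fun h => f.norm_coe_le_norm _)
    ((ContinuousMap.norm_le _ (norm_nonneg _)).2 fun x => ?_)
  obtain ⟨h, rfl⟩ := proj_surjective hS i x
  exact (beta Γ i f).norm_coe_le_norm h

omit [IsTopologicalGroup G] [CompactSpace G] [T2Space G] in
/-- Flux transformations act on the configurations of each graph by two-sided translations. -/
lemma exists_proj_smul_eq_mul_mul {S : Set (Surface d k Sig)} (ρ : limitFluxGroup Γ G S) (i : ℕ) :
    ∃ u v : GraphConn (Γ i) G, ∀ h : LimitConn Γ G, proj Γ G i (ρ • h) = u * proj Γ G i h * v :=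
  ⟨fun e => (ρ.1 i e).1, fun e => (ρ.1 i e).2⁻¹, fun _ => rfl⟩

-- Invariance is expressed through lifts to the limit, so the flux action need not be descended to a
-- single graph.
omit [T2Space G] in
lemma eq_integral_of_fluxAct {S : Set (Surface d k Sig)} (hS : ∀ i, HasSIP S (Γ i)) (i : ℕ)
    (om : C(GraphConn (Γ i) G, ℂ) →L[ℂ] ℂ) (hom : om 1 = 1)
    (hinv : ∀ (ρ : limitFluxGroup Γ G S) f f', beta Γ i f' = fluxAct ρ (beta Γ i f) →
      om f' = om f) (f : C(GraphConn (Γ i) G, ℂ)) :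
    om f = ∫ x, f x ∂(graphHaar (Γ i) G) := by
  obtain ⟨L, hL⟩ := exists_smul_eq_sideMul (G := G) hS i
  refine eq_integral_graphHaar L om hom (fun a f => ?_) f
  obtain ⟨ρ, hρ⟩ := hL a
  -- The inverse appears because `fluxAct` composes with the inverse translation.
  refine hinv ρ⁻¹ _ _ (ContinuousMap.ext fun h => ?_)
  have := hρ h
  simp [beta, fluxAct, this]

/-- Composition with a continuous map, as a continuous linear map. -/
noncomputable def compCLM {X Y : Type*} [TopologicalSpace X] [CompactSpace X] [TopologicalSpace Y]
    [CompactSpace Y] (q : C(X, Y)) : C(Y, ℂ) →L[ℂ] C(X, ℂ) :=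
  LinearMap.mkContinuous
    { toFun := fun f => f.comp q
      map_add' := fun _ _ => rfl
      map_smul' := fun _ _ => rfl } 1 fun f => by
    rw [one_mul]
    exact (ContinuousMap.norm_le _ (norm_nonneg _)).2 fun x => f.norm_coe_le_norm _

lemma compCLM_apply {X Y : Type*} [TopologicalSpace X] [CompactSpace X] [TopologicalSpace Y]
    [CompactSpace Y] (q : C(X, Y)) (f : C(Y, ℂ)) : compCLM q f = f.comp q := rfl

-- The functional $f\mapsto\int f\circ q\,d\mu_j$ is flux invariant, since fluxes act on the graph
-- `j` by two-sided translations. Uniqueness of the invariant functional on the graph `i` then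
-- identifies it, without any analysis of the word map `q`.
omit [T2Space G] in
lemma integral_graphHaar_eq_of_comp {S : Set (Surface d k Sig)} (hS : ∀ i, HasSIP S (Γ i))
    {i j : ℕ} {f : C(GraphConn (Γ i) G, ℂ)}
    {q : C(GraphConn (Γ j) G, GraphConn (Γ i) G)} (hq : ∀ h, q (proj Γ G j h) = proj Γ G i h) :
    ∫ x, f (q x) ∂(graphHaar (Γ j) G) = ∫ x, f x ∂(graphHaar (Γ i) G) := by
  refine eq_integral_of_fluxAct hS i
    ((integralCLM (graphHaar (Γ j) G)).comp (compCLM q))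
    (by simp [integralCLM_apply, compCLM_apply]) (fun ρ f f' hf' => ?_) f
  obtain ⟨u, v, huv⟩ := exists_proj_smul_eq_mul_mul ρ⁻¹ j
  refine Eq.trans ?_ (integral_graphHaar_mul_mul (f.comp q) u v)
  refine integral_congr_ae (.of_forall fun x => ?_)
  obtain ⟨h, rfl⟩ := proj_surjective hS j x
  have := DFunLike.congr_fun hf' h
  simp only [beta, fluxAct, ContinuousMap.comp_apply, ContinuousMap.coe_mk] at this
  simp [hq, ← huv, this, compCLM_apply]

omit [T2Space G] in
lemma integral_graphHaar_eq_of_beta_eq {S : Set (Surface d k Sig)} (hS : ∀ i, HasSIP S (Γ i))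
    (hΓ : DirectedGraphs Γ) {i j : ℕ} {f : C(GraphConn (Γ i) G, ℂ)}
    {g : C(GraphConn (Γ j) G, ℂ)} (hfg : beta Γ i f = beta Γ j g) :
    ∫ x, f x ∂(graphHaar (Γ i) G) = ∫ x, g x ∂(graphHaar (Γ j) G) := by
  obtain ⟨l, hi, hj⟩ := hΓ i j
  obtain ⟨p, hp⟩ := exists_comp_proj_eq (G := G) hi
  obtain ⟨q, hq⟩ := exists_comp_proj_eq (G := G) hj
  rw [← integral_graphHaar_eq_of_comp hS hp, ← integral_graphHaar_eq_of_comp hS hq]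
  refine integral_congr_ae (.of_forall fun x => ?_)
  obtain ⟨h, rfl⟩ := proj_surjective hS l x
  have := DFunLike.congr_fun hfg h
  simpa [hp, hq, beta] using this

/-- The Haar functional on cylinder functions. -/
lemma exists_limit_functional {S : Set (Surface d k Sig)} (hS : ∀ i, HasSIP S (Γ i))
    (hΓ : DirectedGraphs Γ) : ∃ Λ : C(LimitConn Γ G, ℂ) →L[ℂ] ℂ, ‖Λ‖ ≤ 1 ∧
      ∀ i f, Λ (beta Γ i f) = ∫ x, f x ∂(graphHaar (Γ i) G) := by
  -- Each cylinder function gets an arbitrary representative on some graph; `key` shows that the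
  -- Haar integral does not depend on it.
  choose I F hF using fun v : cylinder (G := G) hΓ => exists_beta_of_mem_cylinder v.2
  have key (v : cylinder (G := G) hΓ) {i : ℕ} {f : C(GraphConn (Γ i) G, ℂ)}
      (h : beta Γ i f = v) : ∫ x, F v x ∂(graphHaar (Γ (I v)) G) = ∫ x, f x ∂(graphHaar (Γ i) G) :=
    integral_graphHaar_eq_of_beta_eq hS hΓ ((hF v).trans h.symm)
  let V : Submodule ℂ C(LimitConn Γ G, ℂ) := (cylinder (G := G) hΓ).toSubalgebra.toSubmodule
  let Λ₀ : V →ₗ[ℂ] ℂ :=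
    { toFun := fun v => integralCLM (graphHaar (Γ (I v)) G) (F v)
      map_add' := fun v w => by
        obtain ⟨l, f, g, hf, hg⟩ := hΓ.exists_beta_beta (F v) (F w)
        rw [hF] at hf hg
        have h1 := key v hf
        have h2 := key w hg
        have h3 := key (v + w) (i := l) (f := f + g) (by
          change beta Γ l f + beta Γ l g = _
          rw [hf, hg]; rfl)
        simp only [← integralCLM_apply] at h1 h2 h3
        rw [h1, h2, ← map_add]
        exact h3
      map_smul' := fun c v => by
        have h3 := key (c • v) (i := I v) (f := c • F v) (by
          change c • beta Γ (I v) (F v) = _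
          rw [hF]; rfl)
        simp only [← integralCLM_apply, map_smul] at h3
        exact h3 }
  have hbound (v : V) : ‖Λ₀ v‖ ≤ 1 * ‖v‖ := by
    have h1 : ‖v‖ = ‖F v‖ := by rw [← norm_beta hS, hF]; rfl
    rw [h1, one_mul]
    have := norm_integral_le_of_norm_le_const (μ := graphHaar (Γ (I v)) G)
      (.of_forall (F v).norm_coe_le_norm)
    simp only [probReal_univ, mul_one] at this
    exact this
  -- The Hahn–Banach extension keeps the norm; norm at most one together with `Λ 1 = 1` will give
  -- positivity.
  obtain ⟨Λ, hΛ, hnorm⟩ := exists_extension_norm_eq V (Λ₀.mkContinuous 1 hbound)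
  refine ⟨Λ, hnorm.trans_le (LinearMap.mkContinuous_norm_le _ zero_le_one _), fun i f => ?_⟩
  exact (hΛ ⟨beta Γ i f, beta_mem_cylinder hΓ f⟩).trans (key ⟨_, beta_mem_cylinder hΓ f⟩ rfl)

lemma ext_of_integral_eq {X : Type*} [TopologicalSpace X] [CompactSpace X] [T2Space X]
    [MeasurableSpace X] [BorelSpace X] {μ ν : Measure X} [μ.Regular] [ν.Regular]
    (h : ∀ f : C(X, ℂ), ∫ x, f x ∂μ = ∫ x, f x ∂ν) : μ = ν := by
  refine Measure.ext_of_integral_eq_on_compactlySupported fun f => ?_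
  have := h ⟨fun x => (f x : ℂ), by fun_prop⟩
  simp only [ContinuousMap.coe_mk, integral_complex_ofReal] at this
  exact_mod_cast this

lemma regular_map_of_continuous {X Y : Type*} [TopologicalSpace X] [CompactSpace X] [T2Space X]
    [MeasurableSpace X] [BorelSpace X] [TopologicalSpace Y] [CompactSpace Y] [T2Space Y]
    [MeasurableSpace Y] [BorelSpace Y] {μ : Measure X} [μ.Regular] {f : X → Y}
    (hf : Continuous f) : (μ.map f).Regular := by
  have : (μ.map f).InnerRegular := Measure.InnerRegular.map_of_continuous hf
  infer_instance

instance {Γ : Graph d k Sig} : (graphHaar Γ G).Regular := by unfold graphHaar; infer_instance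

/-- The function $\|f\|\cdot1-f$ takes values in $[0,\|f\|]$, so $\|f\|-\operatorname{Re}\Lambda
f\le\|f\|$. -/
lemma re_nonneg_of_norm_le_one {X : Type*} [TopologicalSpace X] [CompactSpace X]
    {Λ : C(X, ℂ) →L[ℂ] ℂ} (hΛ : ‖Λ‖ ≤ 1) (h1 : Λ 1 = 1) {f : C(X, ℂ)} {g : X → ℝ}
    (hf : ∀ x, f x = g x) (hg : ∀ x, 0 ≤ g x) : 0 ≤ (Λ f).re := by
  have hle : ‖(‖f‖ : ℂ) • (1 : C(X, ℂ)) - f‖ ≤ ‖f‖ := by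
    refine (ContinuousMap.norm_le _ (norm_nonneg _)).2 fun x => ?_
    have h2 := f.norm_coe_le_norm x
    rw [hf, Complex.norm_real, Real.norm_of_nonneg (hg x)] at h2
    have h3 : ((‖f‖ : ℂ) • (1 : C(X, ℂ)) - f) x = ((‖f‖ - g x : ℝ) : ℂ) := by simp [hf]
    rw [h3, Complex.norm_real, Real.norm_of_nonneg (by linarith)]
    linarith [hg x]
  have h4 := (Complex.re_le_norm _).trans ((Λ.le_of_opNorm_le hΛ _).trans_eq (one_mul _))|>.trans hle
  rw [map_sub, map_smul, h1] at h4
  simpa using h4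

/-- Functionals of norm at most one that preserve the unit are integrals. -/
lemma exists_regular_integral_eq {X : Type*} [TopologicalSpace X] [CompactSpace X] [T2Space X]
    [MeasurableSpace X] [BorelSpace X] {Λ : C(X, ℂ) →L[ℂ] ℂ} (hΛ : ‖Λ‖ ≤ 1) (h1 : Λ 1 = 1) :
    ∃ μ : Measure X, μ.Regular ∧ IsFiniteMeasure μ ∧
      ∀ (f : C(X, ℂ)) (g : C(X, ℝ)), (∀ x, f x = g x) → ∫ x, g x ∂μ = (Λ f).re := by
  let ι (g : CompactlySupportedContinuousMap X ℝ) : C(X, ℂ) := ⟨fun x => (g x : ℂ), by fun_prop⟩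
  let P : CompactlySupportedContinuousMap X ℝ →ₚ[ℝ] ℝ :=
    { toFun := fun g => (Λ (ι g)).re
      map_add' := fun g g' => by
        have : ι (g + g') = ι g + ι g' := by ext; simp [ι]
        simp [this]
      map_smul' := fun c g => by
        have : ι (c • g) = (c : ℂ) • ι g := by ext; simp [ι]
        simp [this]
      monotone' := fun g g' hgg' => by
        have := re_nonneg_of_norm_le_one hΛ h1 (f := ι g' - ι g) (g := fun x => g' x - g x)
          (fun x => by simp [ι]) fun x => sub_nonneg.2 (hgg' x)
        simpa using this }
  refine ⟨RealRMK.rieszMeasure P, inferInstance, inferInstance, fun f g hfg => ?_⟩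
  have := RealRMK.integral_rieszMeasure P ⟨g, HasCompactSupport.of_compactSpace _⟩
  have hf : f = ι ⟨g, HasCompactSupport.of_compactSpace _⟩ := ContinuousMap.ext hfg
  rw [hf]
  exact this

omit [T2Space G] in
lemma IsLimitHaar.integral_beta {μ : Measure (LimitConn Γ G)} (hμ : IsLimitHaar Γ G μ) (i : ℕ)
    (f : C(GraphConn (Γ i) G, ℂ)) :
    ∫ h, beta Γ i f h ∂μ = ∫ x, f x ∂(graphHaar (Γ i) G) := by
  rw [← hμ.2 i, integral_map (proj Γ G i).continuous.aemeasurable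
    f.continuous.aestronglyMeasurable]
  rfl

omit [T2Space G] in
lemma IsLimitHaar.isProbabilityMeasure {μ : Measure (LimitConn Γ G)} (hμ : IsLimitHaar Γ G μ) :
    IsProbabilityMeasure μ := by
  constructor
  have h : μ.map (proj Γ G 0) univ = 1 := by rw [hμ.2 0]; exact measure_univ
  rwa [Measure.map_apply (proj Γ G 0).continuous.measurable MeasurableSet.univ] at h

lemma IsLimitHaar.eq_integral {μ : Measure (LimitConn Γ G)} (hμ : IsLimitHaar Γ G μ)
    (hΓ : DirectedGraphs Γ) (om : C(LimitConn Γ G, ℂ) →L[ℂ] ℂ)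
    (h : ∀ i f, om (beta Γ i f) = ∫ x, f x ∂(graphHaar (Γ i) G)) (f : C(LimitConn Γ G, ℂ)) :
    om f = ∫ h, f h ∂μ := by
  have := hμ.isProbabilityMeasure
  rw [← integralCLM_apply]
  refine congrFun (Continuous.ext_on (dense_range_beta hΓ) om.continuous
    (integralCLM μ).continuous fun f hf => ?_) f
  obtain ⟨i, f, rfl⟩ := mem_iUnion.1 hf
  rw [h, integralCLM_apply, hμ.integral_beta]

lemma IsLimitHaar.eq_of_integral_beta (hΓ : DirectedGraphs Γ) {μ ν : Measure (LimitConn Γ G)}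
    (hμ : IsLimitHaar Γ G μ) [ν.Regular] [IsProbabilityMeasure ν]
    (h : ∀ i f, ∫ h, beta Γ i f h ∂ν = ∫ x, f x ∂(graphHaar (Γ i) G)) : ν = μ := by
  have := hμ.1
  exact ext_of_integral_eq fun f => hμ.eq_integral hΓ (integralCLM ν) h f

/-- The translated measure is regular and has the same marginals, because on each graph the flux is
a two-sided translation; marginals determine a regular measure. -/
lemma IsLimitHaar.measurePreserving_smul (hΓ : DirectedGraphs Γ) {μ : Measure (LimitConn Γ G)}
    (hμ : IsLimitHaar Γ G μ) {S : Set (Surface d k Sig)} (ρ : limitFluxGroup Γ G S) :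
    MeasurePreserving (fun h : LimitConn Γ G => ρ • h) μ μ := by
  have hc : Continuous fun h : LimitConn Γ G => ρ • h := continuous_const_smul ρ
  have := hμ.1
  have := hμ.isProbabilityMeasure
  have := regular_map_of_continuous (μ := μ) hc
  have := Measure.isProbabilityMeasure_map (μ := μ) hc.aemeasurable
  refine ⟨hc.measurable, hμ.eq_of_integral_beta hΓ fun i f => ?_⟩
  obtain ⟨u, v, huv⟩ := exists_proj_smul_eq_mul_mul ρ i
  rw [integral_map hc.aemeasurable (beta Γ i f).continuous.aestronglyMeasurable,
    ← integral_graphHaar_mul_mul f u v]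
  refine Eq.trans ?_ (hμ.integral_beta i (f.comp ⟨fun x => u * x * v, by fun_prop⟩))
  simp [beta, huv]

lemma existsUnique_isLimitHaar {S : Set (Surface d k Sig)} (hS : ∀ i, HasSIP S (Γ i))
    (hΓ : DirectedGraphs Γ) : ∃! μ : Measure (LimitConn Γ G), IsLimitHaar Γ G μ := by
  obtain ⟨Λ, hΛ, hΛβ⟩ := exists_limit_functional (G := G) hS hΓ
  have h1 : Λ 1 = 1 := (hΛβ 0 1).trans (by simp)
  obtain ⟨μ, hreg, hfin, hμ⟩ := exists_regular_integral_eq hΛ h1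
  have hlim : IsLimitHaar Γ G μ := by
    refine ⟨hreg, fun i => ?_⟩
    have := regular_map_of_continuous (μ := μ) (proj Γ G i).continuous
    refine Measure.ext_of_integral_eq_on_compactlySupported fun f => ?_
    rw [integral_map (f := f) (proj Γ G i).continuous.aemeasurable
      f.continuous.aestronglyMeasurable]
    let F : C(GraphConn (Γ i) G, ℂ) := ⟨fun x => (f x : ℂ), by fun_prop⟩
    have h2 := hμ (beta Γ i F) (f.toContinuousMap.comp (proj Γ G i)) fun _ => rfl
    rw [hΛβ] at h2
    refine h2.trans ?_
    simp only [F, ContinuousMap.coe_mk, integral_complex_ofReal, Complex.ofReal_re]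
  refine ⟨μ, hlim, fun ν hν => ?_⟩
  have := hν.1
  have := hν.isProbabilityMeasure
  exact hlim.eq_of_integral_beta hΓ hν.integral_beta

end Compact

end Limit

/-! ### States with value one on isometries -/

section States

section Algebraic

variable {A : Type*} [Ring A] [StarRing A] [Algebra ℂ A] [StarModule ℂ A] {om : A →ₗ[ℂ] ℂ}

lemma states.map_star_add_mul_add (om : A →ₗ[ℂ] ℂ) (l : ℂ) (x y : A) :
    om (star (y + l • x) * (y + l • x)) = om (star y * y) +
      (l * om (star y * x) + star l * om (star x * y)) + star l * l * om (star x * x) := by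
  simp only [star_add, star_smul, add_mul, mul_add, smul_mul_assoc, mul_smul_comm, map_add,
    map_smul, smul_eq_mul]
  ring

/-- Polarisation: the value at $(1+la)^*(1+la)$ is real, and $l=1$, $l=i$ give the two components.
-/
lemma states.map_star (hom : om ∈ states A) (a : A) : om (star a) = star (om a) := by
  have key (l : ℂ) : (l * om a + star l * om (star a)).im = 0 := by
    have h1 := (hom.2 (1 + l • a)).1
    have h2 := (hom.2 a).1
    have h3 : star l * l = ((‖l‖ ^ 2 : ℝ) : ℂ) := by
      simpa using Complex.conj_mul' l
    rw [states.map_star_add_mul_add, h3, Complex.add_im, Complex.add_im,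
      Complex.im_ofReal_mul, h2] at h1
    simpa [hom.1] using h1
  have h1 := key 1
  have h2 := key Complex.I
  simp at h1 h2
  refine Complex.ext ?_ ?_ <;> simp <;> linarith

/-- The degenerate case of Cauchy–Schwarz. Positivity at $c^*+tlx$ has no quadratic term in the real
parameter $t$, so the linear coefficient must vanish. -/
lemma states.map_mul_eq_zero (hom : om ∈ states A) {x : A} (hx : om (star x * x) = 0) (c : A) :
    om (c * x) = 0 := by
  have key (l : ℂ) : l * om (c * x) + star l * om (star x * star c) = 0 := by
    set w := l * om (c * x) + star l * om (star x * star c) with hw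
    have h0 := hom.2 (star c)
    have h (t : ℝ) : (om (star (star c) * star c) + t * w).im = 0 ∧
        0 ≤ (om (star (star c) * star c) + t * w).re := by
      have h1 := hom.2 (star c + (t * l) • x)
      rw [states.map_star_add_mul_add, hx, mul_zero, add_zero] at h1
      convert h1 using 4 <;> · simp [hw]; ring
    simp only [Complex.add_im, Complex.add_re, Complex.im_ofReal_mul, Complex.re_ofReal_mul] at h
    refine Complex.ext ?_ ?_
    · by_contra hne
      -- This parameter would make the nonnegative real part equal to $-1$.
      have h2 := (h (-((om (star (star c) * star c)).re + 1) / w.re)).2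
      rw [div_mul_cancel₀ _ hne] at h2
      linarith
    · have := (h 1).1
      rw [h0.1] at this
      simpa using this
  have h1 := key 1
  have h2 := key Complex.I
  simp only [one_mul, star_one] at h1
  simp only [Complex.star_def, Complex.conj_I] at h2
  have h3 : Complex.I * (2 * om (c * x)) = 0 := by linear_combination h2 + Complex.I * h1
  simpa using h3

/-- The variance, that is the value at the square of $a-\omega(a)1$, is nonnegative. -/
lemma states.norm_sq_le (hom : om ∈ states A) (a : A) : ‖om a‖ ^ 2 ≤ (om (star a * a)).re := by
  have h1 := (hom.2 (a + (-om a) • 1)).2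
  rw [states.map_star_add_mul_add] at h1
  simp only [mul_one, star_one, one_mul, hom.1, states.map_star hom] at h1
  have h3 : star (om a) * om a = ((‖om a‖ ^ 2 : ℝ) : ℂ) := by
    simpa using Complex.conj_mul' (om a)
  have h4 : om (star a * a) + (-om a * star (om a) + star (-om a) * om a) +
      star (-om a) * -om a = om (star a * a) - star (om a) * om a := by
    rw [star_neg]; ring
  rw [h4, h3, Complex.sub_re, Complex.ofReal_re] at h1
  linarith

lemma states.norm_le_one (hom : om ∈ states A) {u : A} (hu : star u * u = 1) : ‖om u‖ ≤ 1 := by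
  have := states.norm_sq_le hom u
  rw [hu, hom.1, Complex.one_re] at this
  exact (sq_le_one_iff₀ (norm_nonneg _)).1 this

lemma states.map_mul_sub_one (hom : om ∈ states A) {u : A} (hu : star u * u = 1) (h1 : om u = 1)
    (c : A) : om (c * (u - 1)) = 0 := by
  refine states.map_mul_eq_zero hom ?_ c
  have : star (u - 1) * (u - 1) = 1 - star u - u + 1 := by
    rw [star_sub, star_one, sub_mul, mul_sub, hu]; noncomm_ring
  rw [this]
  simp [hom.1, h1, states.map_star hom]

lemma states.map_mul_of_map_eq_one (hom : om ∈ states A) {u : A} (hu : star u * u = 1)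
    (h1 : om u = 1) (c : A) : om (c * u) = om c := by
  have := states.map_mul_sub_one hom hu h1 c
  rwa [mul_sub, mul_one, map_sub, sub_eq_zero] at this

lemma states.map_conj_of_map_eq_one (hom : om ∈ states A) (u : unitary A) (h1 : om u = 1)
    (a : A) : om ((u : A) * a * star (u : A)) = om a := by
  have h2 : om (star (u : A)) = 1 := by rw [states.map_star hom, h1, star_one]
  rw [states.map_mul_of_map_eq_one hom (by rw [star_star]; exact Unitary.mul_star_self_of_mem u.2) h2,
    ← star_star ((u : A) * a), states.map_star hom, star_mul,
    states.map_mul_of_map_eq_one hom (by rw [star_star]; exact Unitary.mul_star_self_of_mem u.2) h2,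
    states.map_star hom, star_star]

omit [Algebra ℂ A] [StarModule ℂ A] in
lemma conj_eq_of_mul_eq (u : unitary A) {x y : A} (h : (u : A) * x = y * u) :
    (u : A) * x * star (u : A) = y := by
  rw [h, mul_assoc, Unitary.mul_star_self_of_mem u.2, mul_one]

/-- Modulo the left ideals of all states with value one on a normalising set of isometries, every
element of the algebra generated by the image of `M` and the isometries belongs to the image. -/
lemma exists_map_of_mem_adjoin {C : Type*} [Ring C] [StarRing C] [Algebra ℂ C]
    (M : C →⋆ₐ[ℂ] A) {U : Set A} (hU : ∀ u ∈ U, star u * u = 1)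
    (hcov : ∀ u ∈ U, ∃ α : C → C, ∀ f, u * M f = M (α f) * u) {a : A}
    (ha : a ∈ Algebra.adjoin ℂ (range M ∪ U)) :
    ∃ F : C → C, ∀ om ∈ states A, (∀ u ∈ U, om u = 1) →
      ∀ g c, om (c * (a * M g)) = om (c * M (F g)) := by
  -- The map `F` is found before the state, so that two states can be compared through the same `F`;
  -- the free factors `c` and `g` let the products go through.
  induction ha using Algebra.adjoin_induction with
  | mem a ha =>
    rcases ha with ⟨f, rfl⟩ | hu
    · exact ⟨fun g => f * g, fun om _ _ g c => by simp only [map_mul]⟩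
    · obtain ⟨α, hα⟩ := hcov a hu
      refine ⟨α, fun om hom h1 g c => ?_⟩
      rw [hα, ← mul_assoc, states.map_mul_of_map_eq_one hom (hU a hu) (h1 a hu)]
  | algebraMap r =>
    exact ⟨fun g => algebraMap ℂ C r * g, fun om _ _ g c => by
      rw [map_mul M, AlgHomClass.commutes]⟩
  | add a b _ _ h h' =>
    obtain ⟨F, hF⟩ := h
    obtain ⟨F', hF'⟩ := h'
    refine ⟨fun g => F g + F' g, fun om hom h1 g c => ?_⟩
    rw [add_mul, mul_add, map_add, hF om hom h1, hF' om hom h1, map_add M, mul_add, map_add]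
  | mul a b _ _ h h' =>
    obtain ⟨F, hF⟩ := h
    obtain ⟨F', hF'⟩ := h'
    refine ⟨fun g => F (F' g), fun om hom h1 g c => ?_⟩
    rw [mul_assoc, ← mul_assoc c, hF' om hom h1, mul_assoc, hF om hom h1]

lemma re_eq_one_of_convex {z w : ℂ} (hz : ‖z‖ ≤ 1) (hw : ‖w‖ ≤ 1) {a b : ℝ} (ha : 0 < a)
    (hb : 0 < b) (hab : a + b = 1) (h : a * z + b * w = 1) : z = 1 := by
  have h1 := congrArg Complex.re h
  simp only [Complex.add_re, Complex.re_ofReal_mul, Complex.one_re] at h1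
  have hz' := (Complex.re_le_norm z).trans hz
  have hw' := (Complex.re_le_norm w).trans hw
  have hre : z.re = 1 := by nlinarith
  have h2 : z.re ^ 2 + z.im ^ 2 ≤ 1 := by
    have := Complex.sq_norm z
    rw [Complex.normSq_apply] at this
    nlinarith [norm_nonneg z]
  have him : z.im = 0 := by
    rw [hre] at h2
    exact pow_eq_zero_iff (two_ne_zero) |>.1 (le_antisymm (by linarith) (sq_nonneg _))
  exact Complex.ext hre him

/-- A state that is determined by taking the value one on a set of isometries is pure. -/
lemma mem_pureStates_of_unique (hom : om ∈ states A) {U : Set A} (hU : ∀ u ∈ U, star u * u = 1)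
    (h1 : ∀ u ∈ U, om u = 1) (huniq : ∀ om' ∈ states A, (∀ u ∈ U, om' u = 1) → om' = om) :
    om ∈ pureStates A := by
  refine ⟨hom, fun om₁ h₁ om₂ h₂ hseg => ?_⟩
  obtain ⟨a, b, ha, hb, hab, rfl⟩ := hseg
  refine huniq _ h₁ fun u hu => ?_
  exact re_eq_one_of_convex (states.norm_le_one h₁ (hU u hu)) (states.norm_le_one h₂ (hU u hu))
    ha hb hab (by simpa using h1 u hu)

end Algebraic

/-- In a C*-algebra $\|a\|^2-a^*a$ has the form $b^*b$, so $|\omega(a)|^2\le\omega(a^*a)\le\|a\|^2$.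
Continuity of states is what lets density arguments apply. -/
lemma states.norm_le {A : Type*} [CStarAlgebra A] {om : A →ₗ[ℂ] ℂ} (hom : om ∈ states A) (a : A) :
    ‖om a‖ ≤ ‖a‖ := by
  let _ := CStarAlgebra.spectralOrder A
  let _ := CStarAlgebra.spectralOrderedRing A
  have h1 := CStarAlgebra.star_mul_le_algebraMap_norm_sq (a := a)
  obtain ⟨b, hb⟩ := CStarAlgebra.nonneg_iff_eq_star_mul_self.1 (sub_nonneg.2 h1)
  have h2 := (hom.2 b).2
  have h3 : om (algebraMap ℝ A (‖a‖ ^ 2)) = ((‖a‖ ^ 2 : ℝ) : ℂ) := by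
    rw [IsScalarTower.algebraMap_apply ℝ ℂ A, Algebra.algebraMap_eq_smul_one, map_smul, hom.1]
    simp
  rw [← hb, map_sub, h3, Complex.sub_re, Complex.ofReal_re] at h2
  exact abs_le_of_sq_le_sq' (by linarith [states.norm_sq_le hom a]) (norm_nonneg _) |>.2

lemma states.continuous {A : Type*} [CStarAlgebra A] {om : A →ₗ[ℂ] ℂ} (hom : om ∈ states A) :
    Continuous om :=
  (om.mkContinuous 1 fun a => by rw [one_mul]; exact states.norm_le hom a).continuous

/-- States with value one on a normalising set of isometries are determined by their values on the
image of `M`, if this and the isometries generate the algebra. -/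
lemma states.eq_of_map_eq_one {A : Type*} [CStarAlgebra A] {C : Type*} [Ring C] [StarRing C]
    [Algebra ℂ C] (M : C →⋆ₐ[ℂ] A) {U : Set A} (hU : ∀ u ∈ U, star u * u = 1)
    (hcov : ∀ u ∈ U, ∃ α : C → C, ∀ f, u * M f = M (α f) * u)
    (hd : Dense (Algebra.adjoin ℂ (range M ∪ U) : Set A)) {om om' : A →ₗ[ℂ] ℂ}
    (hom : om ∈ states A) (hom' : om' ∈ states A) (h1 : ∀ u ∈ U, om u = 1)
    (h1' : ∀ u ∈ U, om' u = 1) (hM : ∀ f, om (M f) = om' (M f)) : om = om' := by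
  refine DFunLike.coe_injective
    (Continuous.ext_on hd (states.continuous hom) (states.continuous hom') fun a ha => ?_)
  obtain ⟨F, hF⟩ := exists_map_of_mem_adjoin M hU hcov ha
  have h := hF om hom h1 1 1
  have h' := hF om' hom' h1' 1 1
  simp only [map_one, mul_one, one_mul] at h h'
  rw [h, h', hM]

end States

/-! ### Multiplication operators and Weyl elements on $L^2$ -/

section Operators

variable {d : ℕ} {k : WithTop ℕ∞} {Sig : Type*} [TopologicalSpace Sig]
  [ChartedSpace (EuclideanSpace ℝ (Fin d)) Sig] {Γ : ℕ → Graph d k Sig} {G : Type*} [Group G]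
  [TopologicalSpace G] {μ : Measure (LimitConn Γ G)}

section Mul

variable [CompactSpace (LimitConn Γ G)]

-- An operator is determined by its pointwise formula; the algebraic identities for `mulHom` are
-- deduced from this.
omit [CompactSpace (LimitConn Γ G)] in
lemma IsMulOp.unique {f : C(LimitConn Γ G, ℂ)} {T T' : Lp ℂ 2 μ →L[ℂ] Lp ℂ 2 μ}
    (h : IsMulOp f T) (h' : IsMulOp f T') : T = T' :=
  ContinuousLinearMap.ext fun ψ => Lp.ext ((h ψ).trans (h' ψ).symm)

lemma memLp_mul (f : C(LimitConn Γ G, ℂ)) (ψ : Lp ℂ 2 μ) : MemLp (fun h => f h * ψ h) 2 μ :=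
  (Lp.memLp ψ).of_le_mul (c := ‖f‖)
    (f.continuous.aestronglyMeasurable.mul (Lp.aestronglyMeasurable ψ)) (.of_forall fun h => by
      rw [norm_mul]; gcongr; exact f.norm_coe_le_norm h)

variable (μ) in
/-- The operator of multiplication by a continuous function. -/
noncomputable def mulOp (f : C(LimitConn Γ G, ℂ)) : Lp ℂ 2 μ →L[ℂ] Lp ℂ 2 μ :=
  LinearMap.mkContinuous
    { toFun := fun ψ => (memLp_mul f ψ).toLp _
      map_add' := fun ψ φ => by
        apply Lp.ext
        filter_upwards [(memLp_mul f (ψ + φ)).coeFn_toLp, (memLp_mul f ψ).coeFn_toLp,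
          (memLp_mul f φ).coeFn_toLp, Lp.coeFn_add ψ φ,
          Lp.coeFn_add ((memLp_mul f ψ).toLp _) ((memLp_mul f φ).toLp _)] with h h1 h2 h3 h4 h5
        rw [h1, h5, Pi.add_apply, h2, h3, h4, Pi.add_apply, mul_add]
      map_smul' := fun c ψ => by
        apply Lp.ext
        filter_upwards [(memLp_mul f (c • ψ)).coeFn_toLp, (memLp_mul f ψ).coeFn_toLp,
          Lp.coeFn_smul c ψ, Lp.coeFn_smul c ((memLp_mul f ψ).toLp _)] with h h1 h2 h3 h4
        rw [h1, h3, RingHom.id_apply, h4, Pi.smul_apply, Pi.smul_apply, h2, smul_eq_mul,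
          smul_eq_mul, mul_left_comm] } ‖f‖ fun ψ => by
    refine Lp.norm_le_mul_norm_of_ae_le_mul ?_
    filter_upwards [(memLp_mul f ψ).coeFn_toLp] with h h1
    change ‖(memLp_mul f ψ).toLp _ h‖ ≤ _
    rw [h1, norm_mul]
    gcongr
    exact f.norm_coe_le_norm h

lemma norm_mulOp_le (f : C(LimitConn Γ G, ℂ)) : ‖mulOp μ f‖ ≤ ‖f‖ := by
  unfold mulOp
  exact LinearMap.mkContinuous_norm_le _ (norm_nonneg f) _

lemma isMulOp_mulOp (f : C(LimitConn Γ G, ℂ)) : IsMulOp f (mulOp μ f) := fun ψ =>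
  (memLp_mul f ψ).coeFn_toLp

omit [CompactSpace (LimitConn Γ G)] in
lemma IsMulOp.one : IsMulOp (1 : C(LimitConn Γ G, ℂ)) (1 : Lp ℂ 2 μ →L[ℂ] Lp ℂ 2 μ) :=
  fun ψ => .of_forall fun h => by simp

omit [CompactSpace (LimitConn Γ G)] in
lemma IsMulOp.mul {f g : C(LimitConn Γ G, ℂ)} {T T' : Lp ℂ 2 μ →L[ℂ] Lp ℂ 2 μ}
    (hf : IsMulOp f T) (hg : IsMulOp g T') : IsMulOp (f * g) (T * T') := fun ψ => by
  filter_upwards [hf (T' ψ), hg ψ] with h h1 h2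
  change T (T' ψ) h = _
  rw [h1, h2, ContinuousMap.mul_apply, mul_assoc]

omit [CompactSpace (LimitConn Γ G)] in
lemma IsMulOp.add {f g : C(LimitConn Γ G, ℂ)} {T T' : Lp ℂ 2 μ →L[ℂ] Lp ℂ 2 μ}
    (hf : IsMulOp f T) (hg : IsMulOp g T') : IsMulOp (f + g) (T + T') := fun ψ => by
  rw [add_apply]
  filter_upwards [hf ψ, hg ψ, Lp.coeFn_add (T ψ) (T' ψ)] with h h1 h2 h3
  rw [h3, Pi.add_apply, h1, h2, ContinuousMap.add_apply, add_mul]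

omit [CompactSpace (LimitConn Γ G)] in
lemma IsMulOp.smul_one (c : ℂ) :
    IsMulOp (algebraMap ℂ C(LimitConn Γ G, ℂ) c) (c • (1 : Lp ℂ 2 μ →L[ℂ] Lp ℂ 2 μ)) := fun ψ => by
  filter_upwards [Lp.coeFn_smul c ψ] with h h1
  simpa using h1

lemma IsMulOp.adjoint {f : C(LimitConn Γ G, ℂ)} {T : Lp ℂ 2 μ →L[ℂ] Lp ℂ 2 μ}
    (hf : IsMulOp f T) : IsMulOp (star f) (star T) := by
  have : star T = mulOp μ (star f) := by
    rw [ContinuousLinearMap.star_eq_adjoint, eq_comm, ContinuousLinearMap.eq_adjoint_iff]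
    intro ψ φ
    rw [L2.inner_def, L2.inner_def]
    refine integral_congr_ae ?_
    filter_upwards [hf φ, isMulOp_mulOp (μ := μ) (star f) ψ] with h h1 h2
    rw [h1, h2]
    simp only [RCLike.inner_apply, ContinuousMap.star_apply, map_mul, starRingEnd_apply, star_star]
    ring
  rw [this]
  exact isMulOp_mulOp _

/-- Multiplication by continuous functions as a representation. -/
noncomputable def mulHom (μ : Measure (LimitConn Γ G)) (SS : Set (Set (Surface d k Sig))) :
    C(LimitConn Γ G, ℂ) →⋆ₐ[ℂ] weylAlgebra μ SS where
  toFun f := ⟨mulOp μ f, StarSubalgebra.le_topologicalClosure _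
    (StarAlgebra.subset_adjoin ℂ _ (Or.inl ⟨f, isMulOp_mulOp f⟩))⟩
  map_one' := Subtype.ext ((isMulOp_mulOp _).unique IsMulOp.one)
  map_mul' f g := Subtype.ext ((isMulOp_mulOp _).unique ((isMulOp_mulOp f).mul (isMulOp_mulOp g)))
  map_zero' := Subtype.ext ((isMulOp_mulOp _).unique fun ψ => by
    filter_upwards [Lp.coeFn_zero ℂ 2 μ] with h h1
    simpa using h1)
  map_add' f g := Subtype.ext ((isMulOp_mulOp _).unique ((isMulOp_mulOp f).add (isMulOp_mulOp g)))
  commutes' c := Subtype.ext ((isMulOp_mulOp _).unique (by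
    convert IsMulOp.smul_one (μ := μ) c using 1
    rw [← Algebra.algebraMap_eq_smul_one]
    rfl))
  map_star' f := Subtype.ext ((isMulOp_mulOp _).unique (isMulOp_mulOp f).adjoint)

lemma isMulOp_mulHom (SS : Set (Set (Surface d k Sig))) (f : C(LimitConn Γ G, ℂ)) :
    IsMulOp f (mulHom μ SS f).1 := isMulOp_mulOp f

end Mul

section WeylOp

variable {S : Set (Surface d k Sig)}

lemma IsWeylOp.unique {ρ : limitFluxGroup Γ G S} {T T' : Lp ℂ 2 μ →L[ℂ] Lp ℂ 2 μ}
    (h : IsWeylOp ρ T) (h' : IsWeylOp ρ T') : T = T' :=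
  ContinuousLinearMap.ext fun ψ => Lp.ext ((h ψ).trans (h' ψ).symm)

variable (hμ : ∀ (S : Set (Surface d k Sig)) (ρ : limitFluxGroup Γ G S),
  MeasurePreserving (fun h : LimitConn Γ G => ρ • h) μ μ)

/-- The Weyl element of a flux. -/
noncomputable def weylOp (ρ : limitFluxGroup Γ G S) : Lp ℂ 2 μ →L[ℂ] Lp ℂ 2 μ :=
  (Lp.compMeasurePreservingₗᵢ ℂ _ (hμ S ρ⁻¹)).toContinuousLinearMap

lemma isWeylOp_weylOp (ρ : limitFluxGroup Γ G S) : IsWeylOp ρ (weylOp hμ ρ) := fun ψ =>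
  Lp.coeFn_compMeasurePreserving ψ (hμ S ρ⁻¹)

lemma inner_weylOp (ρ : limitFluxGroup Γ G S) (ψ φ : Lp ℂ 2 μ) :
    ⟪weylOp hμ ρ ψ, weylOp hμ ρ φ⟫_ℂ = ⟪ψ, φ⟫_ℂ :=
  (Lp.compMeasurePreservingₗᵢ ℂ _ (hμ S ρ⁻¹)).inner_map_map ψ φ

lemma IsWeylOp.one : IsWeylOp (1 : limitFluxGroup Γ G S) (1 : Lp ℂ 2 μ →L[ℂ] Lp ℂ 2 μ) :=
  fun ψ => .of_forall fun h => by simp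

include hμ in
lemma IsWeylOp.mul {ρ ρ' : limitFluxGroup Γ G S} {T T' : Lp ℂ 2 μ →L[ℂ] Lp ℂ 2 μ}
    (h : IsWeylOp ρ T) (h' : IsWeylOp ρ' T') : IsWeylOp (ρ * ρ') (T * T') := fun ψ => by
  -- The formula for `T'` holds almost everywhere only and is needed at the translated point; the
  -- translation preserves null sets.
  filter_upwards [h (T' ψ), (hμ S ρ⁻¹).quasiMeasurePreserving.ae_eq_comp (h' ψ)] with x h1 h2
  change T (T' ψ) x = _
  rw [h1, mul_inv_rev, mul_smul]
  exact h2

lemma weylOp_mul (ρ ρ' : limitFluxGroup Γ G S) :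
    weylOp hμ (ρ * ρ') = weylOp hμ ρ * weylOp hμ ρ' :=
  (isWeylOp_weylOp hμ _).unique ((isWeylOp_weylOp hμ ρ).mul hμ (isWeylOp_weylOp hμ ρ'))

lemma weylOp_one : weylOp hμ (1 : limitFluxGroup Γ G S) = 1 :=
  (isWeylOp_weylOp hμ _).unique IsWeylOp.one

lemma star_weylOp (ρ : limitFluxGroup Γ G S) : star (weylOp hμ ρ) = weylOp hμ ρ⁻¹ := by
  rw [ContinuousLinearMap.star_eq_adjoint, eq_comm, ContinuousLinearMap.eq_adjoint_iff]
  intro ψ φ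
  have h : weylOp hμ ρ (weylOp hμ ρ⁻¹ ψ) = ψ := by
    change (weylOp hμ ρ * weylOp hμ ρ⁻¹) ψ = ψ
    rw [← weylOp_mul, mul_inv_cancel, weylOp_one]
    rfl
  rw [← inner_weylOp hμ ρ, h]

lemma weylOp_mem {SS : Set (Set (Surface d k Sig))} (hS : S ∈ SS) (ρ : limitFluxGroup Γ G S) :
    weylOp hμ ρ ∈ weylAlgebra μ SS :=
  StarSubalgebra.le_topologicalClosure _
    (StarAlgebra.subset_adjoin ℂ _ (Or.inr ⟨S, hS, ρ, isWeylOp_weylOp hμ ρ⟩))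

/-- The Weyl elements as a unitary representation of the flux group. -/
noncomputable def weylHom {SS : Set (Set (Surface d k Sig))} (S : SS) :
    limitFluxGroup Γ G S.1 →* unitary (weylAlgebra μ SS) where
  toFun ρ := ⟨⟨weylOp hμ ρ, weylOp_mem hμ S.2 ρ⟩, by
    rw [Unitary.mem_iff]
    constructor <;> refine Subtype.ext ?_
    · change star (weylOp hμ ρ) * weylOp hμ ρ = 1
      rw [star_weylOp, ← weylOp_mul, inv_mul_cancel, weylOp_one]
    · change weylOp hμ ρ * star (weylOp hμ ρ) = 1
      rw [star_weylOp, ← weylOp_mul, mul_inv_cancel, weylOp_one]⟩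
  map_one' := Subtype.ext (Subtype.ext (weylOp_one hμ))
  map_mul' ρ ρ' := Subtype.ext (Subtype.ext (weylOp_mul hμ ρ ρ'))

lemma isWeylOp_weylHom {SS : Set (Set (Surface d k Sig))} (S : SS)
    (ρ : limitFluxGroup Γ G S.1) :
    IsWeylOp ρ (weylHom hμ S ρ : weylAlgebra μ SS).1 := isWeylOp_weylOp hμ ρ

lemma weylHom_mul_mulHom [CompactSpace (LimitConn Γ G)] [IsTopologicalGroup G]
    {SS : Set (Set (Surface d k Sig))} (S : SS)
    (ρ : limitFluxGroup Γ G S.1) (f : C(LimitConn Γ G, ℂ)) :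
    (weylHom hμ S ρ : weylAlgebra μ SS) * mulHom μ SS f =
      mulHom μ SS (fluxAct ρ f) * (weylHom hμ S ρ : weylAlgebra μ SS) := by
  refine Subtype.ext (ContinuousLinearMap.ext fun ψ => Lp.ext ?_)
  change weylOp hμ ρ (mulOp μ f ψ) =ᵐ[μ] mulOp μ (fluxAct ρ f) (weylOp hμ ρ ψ)
  filter_upwards [isWeylOp_weylOp hμ ρ (mulOp μ f ψ), isWeylOp_weylOp hμ ρ ψ,
    isMulOp_mulOp (fluxAct ρ f) (weylOp hμ ρ ψ),
    (hμ S ρ⁻¹).quasiMeasurePreserving.ae_eq_comp (isMulOp_mulOp f ψ)] with h h1 h2 h3 h4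
  rw [h1, h3, h2]
  exact h4

end WeylOp

end Operators

/-! ### The vacuum state on the Weyl algebra -/

section Vacuum

variable {d : ℕ} {k : WithTop ℕ∞} {Sig : Type*} [TopologicalSpace Sig]
  [ChartedSpace (EuclideanSpace ℝ (Fin d)) Sig] {Γ : ℕ → Graph d k Sig} {G : Type*} [Group G]
  [TopologicalSpace G] [IsTopologicalGroup G] [CompactSpace G] [T2Space G]
  {μ : Measure (LimitConn Γ G)} {SS : Set (Set (Surface d k Sig))}

/-- Every nonempty open set contains a nonempty open cylinder set, whose measure is the positive
Haar measure of its base. Faithfulness of the multiplication representation rests on this. -/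
lemma IsLimitHaar.isOpenPosMeasure (hΓ : DirectedGraphs Γ) (hμ : IsLimitHaar Γ G μ) :
    μ.IsOpenPosMeasure := by
  refine ⟨fun O hO ⟨x, hx⟩ => ?_⟩
  obtain ⟨F, hF0, hF1, -⟩ := exists_continuous_zero_one_of_isClosed hO.isClosed_compl
    (isClosed_singleton (x := x)) (by simpa using hx)
  -- The bump `F` is 1 at `x` and 0 off `O`; with error below 1/2, the real part of a cylinder
  -- function exceeds 1/2 at `x` and stays below it off `O`.
  obtain ⟨_, hg, hgF⟩ := Metric.dense_iff.1 (dense_range_beta (G := G) hΓ)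
    ⟨fun h => (F h : ℂ), by fun_prop⟩ (1 / 2) (by norm_num)
  obtain ⟨i, g, rfl⟩ := mem_iUnion.1 hgF
  have hclose (h : LimitConn Γ G) : ‖g (proj Γ G i h) - F h‖ < 1 / 2 := by
    have := ContinuousMap.dist_apply_le_dist (f := beta Γ i g) (g := ⟨fun h => (F h : ℂ), by fun_prop⟩) h
    rw [dist_eq_norm] at this
    exact this.trans_lt hg
  let V : Set (GraphConn (Γ i) G) := {y | 1 / 2 < (g y).re}
  have hV : IsOpen V := isOpen_lt continuous_const (Complex.continuous_re.comp g.continuous)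
  have hxV : proj Γ G i x ∈ V := by
    have h1 := (Complex.abs_re_le_norm _).trans_lt (hclose x)
    have h2 : F x = 1 := hF1 rfl
    rw [Complex.sub_re, Complex.ofReal_re, h2, abs_lt] at h1
    change 1 / 2 < (g (proj Γ G i x)).re
    linarith
  have hsub : proj Γ G i ⁻¹' V ⊆ O := by
    intro h hh
    by_contra hn
    have h1 := (Complex.abs_re_le_norm _).trans_lt (hclose h)
    have h2 : F h = 0 := hF0 hn
    rw [Complex.sub_re, Complex.ofReal_re, h2, abs_lt] at h1
    have : 1 / 2 < (g (proj Γ G i h)).re := hh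
    linarith
  have hpos : 0 < μ (proj Γ G i ⁻¹' V) := by
    rw [← Measure.map_apply (proj Γ G i).continuous.measurable hV.measurableSet, hμ.2 i]
    exact hV.measure_pos _ ⟨_, hxV⟩
  exact (hpos.trans_le (measure_mono hsub)).ne'

section

variable [IsProbabilityMeasure μ]

variable (μ) in
/-- The constant function one. -/
noncomputable def vacuum : Lp ℂ 2 μ := ContinuousMap.toLp 2 μ ℂ 1

lemma coeFn_vacuum : vacuum μ =ᵐ[μ] fun _ => 1 :=
  ContinuousMap.coeFn_toLp (p := 2) (𝕜 := ℂ) μ (1 : C(LimitConn Γ G, ℂ))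

lemma norm_vacuum : ‖vacuum μ‖ = 1 := by
  have h : ⟪vacuum μ, vacuum μ⟫_ℂ = 1 := by
    rw [vacuum, ContinuousMap.inner_toLp]
    simp
  have h2 := inner_self_eq_norm_sq (𝕜 := ℂ) (vacuum μ)
  rw [h, RCLike.one_re] at h2
  exact (pow_eq_one_iff_of_nonneg (norm_nonneg _) two_ne_zero).1 h2.symm

lemma mulOp_vacuum (f : C(LimitConn Γ G, ℂ)) :
    mulOp μ f (vacuum μ) = ContinuousMap.toLp 2 μ ℂ f := by
  apply Lp.ext
  filter_upwards [isMulOp_mulOp f (vacuum μ), coeFn_vacuum (μ := μ),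
    ContinuousMap.coeFn_toLp (p := 2) (𝕜 := ℂ) μ f] with h h1 h2 h3
  rw [h1, h2, h3, mul_one]

lemma mulHom_injective [μ.IsOpenPosMeasure] : Function.Injective (mulHom μ SS) := by
  intro f g hfg
  have h : mulOp μ f = mulOp μ g := congrArg Subtype.val hfg
  have h2 := DFunLike.congr_fun h (vacuum μ)
  rw [mulOp_vacuum, mulOp_vacuum] at h2
  have h3 : (f : LimitConn Γ G → ℂ) =ᵐ[μ] g :=
    (ContinuousMap.coeFn_toLp (p := 2) (𝕜 := ℂ) μ f).symm.trans
      (h2 ▸ ContinuousMap.coeFn_toLp (p := 2) (𝕜 := ℂ) μ g)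
  exact DFunLike.coe_injective ((f.continuous.ae_eq_iff_eq μ g.continuous).1 h3)

variable (μ SS) in
/-- The vacuum expectation. -/
noncomputable def vacuumState : weylAlgebra μ SS →ₗ[ℂ] ℂ where
  toFun a := ⟪vacuum μ, a.1 (vacuum μ)⟫_ℂ
  map_add' _ _ := inner_add_right _ _ _
  map_smul' _ _ := inner_smul_right _ _ _

lemma vacuumState_apply (a : weylAlgebra μ SS) :
    vacuumState μ SS a = ⟪vacuum μ, a.1 (vacuum μ)⟫_ℂ := rfl

lemma vacuumState_mem_states : vacuumState μ SS ∈ states (weylAlgebra μ SS) := by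
  constructor
  · change ⟪vacuum μ, vacuum μ⟫_ℂ = 1
    rw [inner_self_eq_norm_sq_to_K, norm_vacuum]
    simp
  · intro a
    have h : vacuumState μ SS (star a * a) = ((‖a.1 (vacuum μ)‖ ^ 2 : ℝ) : ℂ) := by
      change ⟪vacuum μ, ContinuousLinearMap.adjoint a.1 (a.1 (vacuum μ))⟫_ℂ = _
      rw [ContinuousLinearMap.adjoint_inner_right, inner_self_eq_norm_sq_to_K]
      simp
    rw [h]
    exact ⟨Complex.ofReal_im _, by rw [Complex.ofReal_re]; positivity⟩

lemma vacuumState_mulHom (f : C(LimitConn Γ G, ℂ)) :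
    vacuumState μ SS (mulHom μ SS f) = ∫ h, f h ∂μ := by
  change ⟪vacuum μ, mulOp μ f (vacuum μ)⟫_ℂ = _
  rw [mulOp_vacuum, vacuum, ContinuousMap.inner_toLp]
  simp

lemma dense_range_vacuum [μ.Regular] :
    Dense (range fun a : weylAlgebra μ SS => a.1 (vacuum μ)) := by
  refine (ContinuousMap.toLp_denseRange ℂ μ ℂ (p := 2) (by simp)).mono ?_
  rintro _ ⟨f, rfl⟩
  exact ⟨mulHom μ SS f, mulOp_vacuum f⟩

lemma dense_cylinder_Lp (hΓ : DirectedGraphs Γ) (hμ : IsLimitHaar Γ G μ) :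
    Dense {ψ : Lp ℂ 2 μ | ∃ i, ∃ φ : Lp ℂ 2 (graphHaar (Γ i) G),
      ψ =ᵐ[μ] fun h => φ (proj Γ G i h)} := by
  have := hμ.1
  refine ((ContinuousMap.toLp_denseRange ℂ μ ℂ (p := 2) (by simp)).dense_image
    (ContinuousMap.toLp 2 μ ℂ).continuous (dense_range_beta hΓ)).mono ?_
  rintro _ ⟨F, hF, rfl⟩
  obtain ⟨i, f, rfl⟩ := mem_iUnion.1 hF
  refine ⟨i, ContinuousMap.toLp 2 _ ℂ f, ?_⟩
  have hp : MeasurePreserving (proj Γ G i) μ (graphHaar (Γ i) G) :=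
    ⟨(proj Γ G i).continuous.measurable, hμ.2 i⟩
  exact (ContinuousMap.coeFn_toLp (p := 2) (𝕜 := ℂ) μ (beta Γ i f)).trans
    (hp.quasiMeasurePreserving.ae_eq_comp
      (ContinuousMap.coeFn_toLp (p := 2) (𝕜 := ℂ) _ f)).symm

end

omit [IsTopologicalGroup G] [CompactSpace G] [T2Space G] in
lemma isClosed_weylAlgebra : IsClosed (weylAlgebra μ SS : Set (Lp ℂ 2 μ →L[ℂ] Lp ℂ 2 μ)) :=
  StarSubalgebra.isClosed_topologicalClosure _

lemma norm_mulHom_le (f : C(LimitConn Γ G, ℂ)) : ‖mulHom μ SS f‖ ≤ ‖f‖ :=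
  norm_mulOp_le f

omit [IsTopologicalGroup G] [CompactSpace G] [T2Space G] in
lemma states.norm_le_of_weylAlgebra {om : weylAlgebra μ SS →ₗ[ℂ] ℂ}
    (hom : om ∈ states (weylAlgebra μ SS)) (a : weylAlgebra μ SS) : ‖om a‖ ≤ 1 * ‖a‖ := by
  have := isClosed_weylAlgebra (μ := μ) (SS := SS)
  rw [one_mul]
  exact states.norm_le hom a

/-- The restriction of a state to the continuous functions. -/
noncomputable def states.restrict {om : weylAlgebra μ SS →ₗ[ℂ] ℂ}
    (hom : om ∈ states (weylAlgebra μ SS)) : C(LimitConn Γ G, ℂ) →L[ℂ] ℂ :=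
  (om ∘ₗ (mulHom μ SS).toAlgHom.toLinearMap).mkContinuous 1 fun f =>
    (states.norm_le_of_weylAlgebra hom _).trans
      (mul_le_mul_of_nonneg_left (norm_mulHom_le f) zero_le_one)

lemma states.restrict_apply {om : weylAlgebra μ SS →ₗ[ℂ] ℂ}
    (hom : om ∈ states (weylAlgebra μ SS)) (f : C(LimitConn Γ G, ℂ)) :
    states.restrict hom f = om (mulHom μ SS f) := rfl

/-- Pulled back to each graph, the state is a flux-invariant normalised functional, hence the Haar
integral; density of cylinder functions does the rest. -/
lemma states.eq_integral (hΓ : DirectedGraphs Γ) (hμ : IsLimitHaar Γ G μ)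
    {S : Set (Surface d k Sig)} (hS : ∀ i, HasSIP S (Γ i)) {om : weylAlgebra μ SS →ₗ[ℂ] ℂ}
    (hom : om ∈ states (weylAlgebra μ SS))
    (hinv : ∀ (ρ : limitFluxGroup Γ G S) f, om (mulHom μ SS (fluxAct ρ f)) = om (mulHom μ SS f))
    (f : C(LimitConn Γ G, ℂ)) : om (mulHom μ SS f) = ∫ h, f h ∂μ := by
  rw [← states.restrict_apply hom]
  refine hμ.eq_integral hΓ (states.restrict hom) (fun i f => ?_) f
  refine eq_integral_of_fluxAct hS i ((states.restrict hom).comp (compCLM (proj Γ G i)))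
    ?_ (fun ρ f f' h => ?_) f
  · exact (congrArg om (map_one (mulHom μ SS))).trans hom.1
  · change states.restrict hom (beta Γ i f') = states.restrict hom (beta Γ i f)
    rw [h]
    exact hinv ρ _

section Unique

variable (hρ : ∀ (S : Set (Surface d k Sig)) (ρ : limitFluxGroup Γ G S),
  MeasurePreserving (fun h : LimitConn Γ G => ρ • h) μ μ)

lemma weylHom_vacuum [IsProbabilityMeasure μ] (S : SS) (ρ : limitFluxGroup Γ G S.1) :
    (weylHom hρ S ρ : weylAlgebra μ SS).1 (vacuum μ) = vacuum μ := by
  apply Lp.ext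
  filter_upwards [isWeylOp_weylHom hρ S ρ (vacuum μ), coeFn_vacuum (μ := μ),
    (hρ S ρ⁻¹).quasiMeasurePreserving.ae_eq_comp (coeFn_vacuum (μ := μ))] with h h1 h2 h3
  rw [h1, h2]
  exact h3

lemma vacuumState_weylHom [IsProbabilityMeasure μ] (S : SS) (ρ : limitFluxGroup Γ G S.1) :
    vacuumState μ SS (weylHom hρ S ρ : weylAlgebra μ SS) = 1 := by
  rw [vacuumState_apply, weylHom_vacuum, inner_self_eq_norm_sq_to_K, norm_vacuum]
  simp

lemma weylHom_conj_mulHom (S : SS) (ρ : limitFluxGroup Γ G S.1) (f : C(LimitConn Γ G, ℂ)) :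
    (weylHom hρ S ρ : weylAlgebra μ SS) * mulHom μ SS f *
      star (weylHom hρ S ρ : weylAlgebra μ SS) = mulHom μ SS (fluxAct ρ f) :=
  conj_eq_of_mul_eq _ (weylHom_mul_mulHom hρ S ρ f)

variable (SS) in
/-- The set of all Weyl elements. -/
def weylElements : Set (weylAlgebra μ SS) :=
  {u | ∃ (S : SS) (ρ : limitFluxGroup Γ G S.1), (weylHom hρ S ρ : weylAlgebra μ SS) = u}

/-- The generators are closed under adjoints, by $M(f)^*=M(\bar f)$ and $U(\rho)^*=U(\rho^{-1})$, so
the plain algebra they generate is already the star algebra whose closure defines `weylAlgebra`. -/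
lemma dense_adjoin_weylElements :
    Dense (Algebra.adjoin ℂ (range (mulHom μ SS) ∪ weylElements SS hρ) :
      Set (weylAlgebra μ SS)) := by
  have hmul {f : C(LimitConn Γ G, ℂ)} {T : Lp ℂ 2 μ →L[ℂ] Lp ℂ 2 μ} (hf : IsMulOp f T) :
      ∃ a ∈ Algebra.adjoin ℂ (range (mulHom μ SS) ∪ weylElements SS hρ), a.1 = T :=
    ⟨mulHom μ SS f, Algebra.subset_adjoin (Or.inl ⟨f, rfl⟩), (isMulOp_mulOp f).unique hf⟩
  have hweyl {S : Set (Surface d k Sig)} (hS : S ∈ SS) {ρ : limitFluxGroup Γ G S}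
      {T : Lp ℂ 2 μ →L[ℂ] Lp ℂ 2 μ} (hf : IsWeylOp ρ T) :
      ∃ a ∈ Algebra.adjoin ℂ (range (mulHom μ SS) ∪ weylElements SS hρ), a.1 = T :=
    ⟨weylHom hρ ⟨S, hS⟩ ρ, Algebra.subset_adjoin (Or.inr ⟨⟨S, hS⟩, ρ, rfl⟩),
      (isWeylOp_weylOp hρ ρ).unique hf⟩
  refine Subtype.dense_iff.2 fun T hT => closure_mono ?_ hT
  intro T hT
  rw [SetLike.mem_coe, ← StarSubalgebra.mem_toSubalgebra, StarAlgebra.adjoin_toSubalgebra] at hT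
  suffices h : ∃ a ∈ Algebra.adjoin ℂ (range (mulHom μ SS) ∪ weylElements SS hρ), a.1 = T from h
  induction hT using Algebra.adjoin_induction with
  | mem T hT =>
    rcases hT with (⟨f, hf⟩ | ⟨S, hS, ρ, hf⟩) | (⟨f, hf⟩ | ⟨S, hS, ρ, hf⟩)
    · exact hmul hf
    · exact hweyl hS hf
    · exact hmul (f := star f) (by simpa using hf.adjoint)
    · refine hweyl hS (ρ := ρ⁻¹) ?_
      rw [← star_star T, hf.unique (isWeylOp_weylOp hρ ρ), star_weylOp]
      exact isWeylOp_weylOp hρ _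
  | algebraMap r => exact ⟨algebraMap ℂ _ r, Subalgebra.algebraMap_mem _ r, rfl⟩
  | add T T' _ _ h h' =>
    obtain ⟨a, ha, rfl⟩ := h
    obtain ⟨b, hb, rfl⟩ := h'
    exact ⟨a + b, add_mem ha hb, rfl⟩
  | mul T T' _ _ h h' =>
    obtain ⟨a, ha, rfl⟩ := h
    obtain ⟨b, hb, rfl⟩ := h'
    exact ⟨a * b, mul_mem ha hb, rfl⟩

lemma states.eq_of_weylElements {om om' : weylAlgebra μ SS →ₗ[ℂ] ℂ}
    (hom : om ∈ states (weylAlgebra μ SS)) (hom' : om' ∈ states (weylAlgebra μ SS))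
    (h1 : ∀ u ∈ weylElements SS hρ, om u = 1) (h1' : ∀ u ∈ weylElements SS hρ, om' u = 1)
    (hM : ∀ f, om (mulHom μ SS f) = om' (mulHom μ SS f)) : om = om' := by
  -- Closedness makes the subalgebra a C*-algebra, as continuity of states requires.
  have := isClosed_weylAlgebra (μ := μ) (SS := SS)
  refine states.eq_of_map_eq_one (mulHom μ SS) (U := weylElements SS hρ) ?_ ?_
    (dense_adjoin_weylElements hρ) hom hom' h1 h1' hM
  · rintro _ ⟨S, ρ, rfl⟩
    exact Unitary.star_mul_self_of_mem (weylHom hρ S ρ).2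
  · rintro _ ⟨S, ρ, rfl⟩
    exact ⟨fluxAct ρ, weylHom_mul_mulHom hρ S ρ⟩

lemma states.mulHom_fluxAct_of_conj {om : weylAlgebra μ SS →ₗ[ℂ] ℂ} (S : SS)
    (ρ : limitFluxGroup Γ G S.1)
    (h : ∀ a, om ((weylHom hρ S ρ : weylAlgebra μ SS) * a *
      star (weylHom hρ S ρ : weylAlgebra μ SS)) = om a) (f : C(LimitConn Γ G, ℂ)) :
    om (mulHom μ SS (fluxAct ρ f)) = om (mulHom μ SS f) :=
  (congrArg om (weylHom_conj_mulHom hρ S ρ f)).symm.trans (h _)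

end Unique

end Vacuum

end HolonomyFlux
-- The proposition
theorem mainTheorem3 {d : ℕ} {k : WithTop ℕ∞} (hk : 1 ≤ k) {Sig : Type*} [TopologicalSpace Sig]
    [T2Space Sig] [ChartedSpace (EuclideanSpace ℝ (Fin d)) Sig] [IsManifold (𝓡 d) k Sig]
    {G : Type*} [Group G] [TopologicalSpace G] [IsTopologicalGroup G] [CompactSpace G] [T2Space G]
    (Γ : ℕ → HolonomyFlux.Graph d k Sig)
    (hΓ : ∀ i j, ∃ l, HolonomyFlux.IsSubgraph (Γ i) (Γ l) ∧ HolonomyFlux.IsSubgraph (Γ j) (Γ l))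
    (SS : Set (Set (HolonomyFlux.Surface d k Sig))) (hSS : SS.Nonempty)
    (hSIP : ∀ S ∈ SS, ∀ i, HolonomyFlux.HasSIP S (Γ i)) :
    -- the graph systems form an inductive family, with limit their union
    (∀ i j, ∃ l, HolonomyFlux.GraphSystemLE (Γ i) (Γ l) ∧ HolonomyFlux.GraphSystemLE (Γ j) (Γ l)) ∧
    (∀ Δ, Δ ∈ HolonomyFlux.limitGraphSystem Γ ↔
      ∃ i, HolonomyFlux.GraphSystemLE Δ (Γ i)) ∧
    -- the functions on the limit are the C*-inductive limit of the functions on the graphs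
    (∀ i, Function.Injective (HolonomyFlux.beta (G := G) Γ i)) ∧
    Dense (⋃ i, range (HolonomyFlux.beta (G := G) Γ i)) ∧
    -- the limit measure exists and is unique
    (∃! μ : Measure (HolonomyFlux.LimitConn Γ G), HolonomyFlux.IsLimitHaar Γ G μ) ∧
    ∀ μ : Measure (HolonomyFlux.LimitConn Γ G), HolonomyFlux.IsLimitHaar Γ G μ →
      -- the Hilbert space is the limit of the Hilbert spaces of the graphs
      Dense {ψ : Lp ℂ 2 μ | ∃ i, ∃ φ : Lp ℂ 2 (HolonomyFlux.graphHaar (Γ i) G),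
        ψ =ᵐ[μ] fun h => φ (HolonomyFlux.proj Γ G i h)} ∧
      ∃ (M : C(HolonomyFlux.LimitConn Γ G, ℂ) →⋆ₐ[ℂ] HolonomyFlux.weylAlgebra μ SS)
        (U : ∀ S : SS, HolonomyFlux.limitFluxGroup Γ G S.1 →*
          unitary (HolonomyFlux.weylAlgebra μ SS))
        (Φ : HolonomyFlux.weylAlgebra μ SS →⋆ₐ[ℂ] (Lp ℂ 2 μ →L[ℂ] Lp ℂ 2 μ))
        (Ω : Lp ℂ 2 μ)
        (om : HolonomyFlux.weylAlgebra μ SS →ₗ[ℂ] ℂ),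
        -- the generators and their representation
        Function.Injective M ∧
        (∀ f, HolonomyFlux.IsMulOp f (M f).1) ∧
        (∀ S ρ, HolonomyFlux.IsWeylOp ρ (U S ρ : HolonomyFlux.weylAlgebra μ SS).1) ∧
        (∀ f, HolonomyFlux.IsMulOp f (Φ (M f))) ∧
        (∀ S ρ, HolonomyFlux.IsWeylOp ρ (Φ (U S ρ : HolonomyFlux.weylAlgebra μ SS))) ∧
        (∀ S ρ f, (U S ρ : HolonomyFlux.weylAlgebra μ SS) * M f *
          star (U S ρ : HolonomyFlux.weylAlgebra μ SS) = M (HolonomyFlux.fluxAct ρ f)) ∧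
        -- the GNS triple of the state `om`
        (Ω =ᵐ[μ] fun _ => 1) ∧ ‖Ω‖ = 1 ∧
        Dense (range fun a => Φ a Ω) ∧
        (∀ a, om a = ⟪Ω, Φ a Ω⟫_ℂ) ∧
        -- the state is pure and restricts to the Haar integral
        om ∈ HolonomyFlux.pureStates (HolonomyFlux.weylAlgebra μ SS) ∧
        (∀ f, om (M f) = ∫ h, f h ∂μ) ∧
        (∀ i f, om (M (HolonomyFlux.beta Γ i f)) =
          ∫ h, f h ∂(HolonomyFlux.graphHaar (Γ i) G)) ∧
        -- it takes the value one on the Weyl elements, and on the products `U* U`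
        (∀ S ρ, om (U S ρ : HolonomyFlux.weylAlgebra μ SS) = 1) ∧
        (∀ S ρ, om (star (U S ρ : HolonomyFlux.weylAlgebra μ SS) *
          (U S ρ : HolonomyFlux.weylAlgebra μ SS)) = 1) ∧
        -- it is invariant under the flux groups
        (∀ S ρ a, om ((U S ρ : HolonomyFlux.weylAlgebra μ SS) * a *
          star (U S ρ : HolonomyFlux.weylAlgebra μ SS)) = om a) ∧
        -- it is the only state with value one on the Weyl elements
        (∀ om' ∈ HolonomyFlux.states (HolonomyFlux.weylAlgebra μ SS),
          (∀ S ρ, om' (U S ρ : HolonomyFlux.weylAlgebra μ SS) = 1) → om' = om) ∧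
        -- every state that is invariant under the flux groups restricts to the Haar integral
        (∀ om' ∈ HolonomyFlux.states (HolonomyFlux.weylAlgebra μ SS),
          (∀ S ρ a, om' ((U S ρ : HolonomyFlux.weylAlgebra μ SS) * a *
            star (U S ρ : HolonomyFlux.weylAlgebra μ SS)) = om' a) →
          ∀ f, om' (M f) = om (M f)) := by
  have hdir : HolonomyFlux.DirectedGraphs Γ := hΓ
  -- A single surface set already supplies all one-sided translations.
  obtain ⟨S₀, hS₀⟩ := hSS
  have hS := hSIP S₀ hS₀
  refine ⟨fun i j => ?_, fun Δ => HolonomyFlux.mem_limitGraphSystem_iff,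
    HolonomyFlux.beta_injective hS, HolonomyFlux.dense_range_beta hdir,
    HolonomyFlux.existsUnique_isLimitHaar hS hdir, fun μ hμ => ?_⟩
  · obtain ⟨l, hi, hj⟩ := hΓ i j
    exact ⟨l, HolonomyFlux.graphSystemLE_iff.2 hi, HolonomyFlux.graphSystemLE_iff.2 hj⟩
  have := hμ.1
  have := hμ.isProbabilityMeasure
  have := hμ.isOpenPosMeasure hdir
  have hρ : ∀ (S : Set (HolonomyFlux.Surface d k Sig)) (ρ : HolonomyFlux.limitFluxGroup Γ G S),
      MeasurePreserving (fun h : HolonomyFlux.LimitConn Γ G => ρ • h) μ μ := fun S ρ =>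
    hμ.measurePreserving_smul hdir ρ
  have hvac := HolonomyFlux.vacuumState_mem_states (μ := μ) (SS := SS)
  have hvac1 := HolonomyFlux.vacuumState_weylHom (SS := SS) hρ
  -- Value one on Weyl elements forces invariance under conjugation by them, hence the Haar integral
  -- on functions, hence equality with the vacuum state.
  have huniq : ∀ om' ∈ HolonomyFlux.states (HolonomyFlux.weylAlgebra μ SS),
      (∀ u ∈ HolonomyFlux.weylElements SS hρ, om' u = 1) →
        om' = HolonomyFlux.vacuumState μ SS := fun om' hom' h1 =>
    HolonomyFlux.states.eq_of_weylElements hρ hom' hvac h1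
      (by rintro _ ⟨S, ρ, rfl⟩; exact hvac1 S ρ) fun f => by
        rw [HolonomyFlux.vacuumState_mulHom]
        refine HolonomyFlux.states.eq_integral hdir hμ hS hom' (fun ρ f => ?_) f
        exact HolonomyFlux.states.mulHom_fluxAct_of_conj hρ ⟨S₀, hS₀⟩ ρ
          (HolonomyFlux.states.map_conj_of_map_eq_one hom' _ (h1 _ ⟨⟨S₀, hS₀⟩, ρ, rfl⟩)) f
  -- The algebra already acts on $L^2$, so the representation is the inclusion. The constant
  -- function is cyclic because $M(f)1=f$ and continuous functions are dense.
  refine ⟨HolonomyFlux.dense_cylinder_Lp hdir hμ, HolonomyFlux.mulHom μ SS,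
    HolonomyFlux.weylHom hρ, (HolonomyFlux.weylAlgebra μ SS).subtype, HolonomyFlux.vacuum μ,
    HolonomyFlux.vacuumState μ SS, HolonomyFlux.mulHom_injective,
    HolonomyFlux.isMulOp_mulHom SS, HolonomyFlux.isWeylOp_weylHom hρ,
    HolonomyFlux.isMulOp_mulHom SS, HolonomyFlux.isWeylOp_weylHom hρ,
    HolonomyFlux.weylHom_conj_mulHom hρ, HolonomyFlux.coeFn_vacuum, HolonomyFlux.norm_vacuum,
    HolonomyFlux.dense_range_vacuum, HolonomyFlux.vacuumState_apply, ?_,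
    HolonomyFlux.vacuumState_mulHom, fun i f => ?_, hvac1, fun S ρ => ?_,
    fun S ρ => HolonomyFlux.states.map_conj_of_map_eq_one hvac _ (hvac1 S ρ),
    fun om' hom' h1 => huniq om' hom' (by rintro _ ⟨S, ρ, rfl⟩; exact h1 S ρ),
    fun om' hom' hinv f => ?_⟩
  · refine HolonomyFlux.mem_pureStates_of_unique hvac (U := HolonomyFlux.weylElements SS hρ)
      ?_ ?_ huniq
    · rintro _ ⟨S, ρ, rfl⟩
      exact Unitary.star_mul_self_of_mem (HolonomyFlux.weylHom hρ S ρ).2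
    · rintro _ ⟨S, ρ, rfl⟩
      exact hvac1 S ρ
  · exact (HolonomyFlux.vacuumState_mulHom _).trans (hμ.integral_beta i f)
  · exact (congrArg _ (Unitary.star_mul_self_of_mem (HolonomyFlux.weylHom hρ S ρ).2)).trans hvac.1
  · rw [HolonomyFlux.vacuumState_mulHom]
    exact HolonomyFlux.states.eq_integral hdir hμ hS hom' (fun ρ f =>
      HolonomyFlux.states.mulHom_fluxAct_of_conj hρ ⟨S₀, hS₀⟩ ρ (hinv ⟨S₀, hS₀⟩ ρ) f) f
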